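/- Let $\mathcal H$ be a separable complex Hilbert space and let $\mathcal P(\mathcal H)=\{P\in\mathcal B(\mathcal H): P=P^2=P^*\}$ be the set of orthogonal projections; $R(P)$ and $N(P)$ denote range and nullspace. Let $\Delta$ (resp. $\Gamma$) be the set of pairs $(P,Q)\in\mathcal P(\mathcal H)\times\mathcal P(\mathcal H)$ for which there exists (resp. does not exist) a closed subspace $\mathcal Z\subseteq\mathcal H$ with $R(P)\dotplus\mathcal Z=R(Q)\dotplus\mathcal Z=\mathcal H$ (direct sums). Fix an orthogonal decomposition $\mathcal H=\mathcal H_+\oplus\mathcal H_-$ into closed infinite-dimensional subspaces, and let $P_+$ be the orthogonal projection onto $\mathcal H_+$. Put $$Gr_{res}=\{P\in\mathcal P(\mathcal H): P-P_+ \text{ is compact}\},\qquad Gr_{res}^{(k)}=\{P\in Gr_{res}: \operatorname{index}(P_+,P)=k\}\quad (k\in\mathbb Z),$$ where $\operatorname{index}(P,Q)$ is the Fredholm index of $Q|_{R(P)}:R(P)\to R(Q)$ (an operator which is Fredholm when $P-Q$ is compact). A geodesic of $\mathcal P(\mathcal H)$ is a smooth curve $\delta:[0,1]\to\mathcal P(\mathcal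 H)$ with $\delta\,\ddot\delta\,(1-\delta)+(1-\delta)\,\ddot\delta\,\delta=0$ on $[0,1]$. A geodesic of $\mathcal P(\mathcal H)\times\mathcal P(\mathcal H)$ is a curve $\delta=(\delta_1,\delta_2)$ whose components are geodesics of $\mathcal P(\mathcal H)$; it is minimizing if its length $L(\delta)=\int_0^1(\|\dot\delta_1\|^2+\|\dot\delta_2\|^2)^{1/2}\,dt$ (operator norms) is at most that of every piecewise $C^1$ curve in $\mathcal P(\mathcal H)\times\mathcal P(\mathcal H)$ with the same endpoints. Then: (i) For every $k\in\mathbb Z$, $Gr_{res}^{(k)}\times Gr_{res}^{(k)}\subseteq\Delta$, and any two points of $Gr_{res}^{(k)}\times Gr_{res}^{(k)}$ can be joined by a minimizing geodesic of $\mathcal P(\mathcal H)\times\mathcal P(\mathcal H)$ contained in $\Delta$. (ii) For all $k\neq j$ in $\mathbb Z$, $Gr_{res}^{(k)}\times Gr_{res}^{(j)}\subseteq\Gamma$, and any two points of $Gr_{res}^{(k)}\times Gr_{res}^{(j)}$ can be joined by a minimizing geodesic of $\mathcal P(\mathcal H)\times\mathcal P(\mathcal H)$ contained in $\Gamma$.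 -/

import Mathlib

open Set
open scoped ContDiff

noncomputable section

namespace CommonComplement

variable {H : Type*} [NormedAddCommGroup H] [InnerProductSpace ℂ H] [CompleteSpace H]

/-- The set `P(H)` of orthogonal projections, `P = P² = P*`. -/
def projections (H : Type*) [NormedAddCommGroup H] [InnerProductSpace ℂ H] [CompleteSpace H] :
    Set (H →L[ℂ] H) :=
  {P | IsStarProjection P}

/-- Two subspaces have a common (closed) complement. -/
def HaveCommonComplement (S T : Submodule ℂ H) : Prop :=
  ∃ Z : Submodule ℂ H, IsClosed (Z : Set H) ∧ IsCompl S Z ∧ IsCompl T Z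

/-- Pairs of orthogonal projections whose ranges have a common complement. -/
def Delta (H : Type*) [NormedAddCommGroup H] [InnerProductSpace ℂ H] [CompleteSpace H] :
    Set ((H →L[ℂ] H) × (H →L[ℂ] H)) :=
  {p | p.1 ∈ projections H ∧ p.2 ∈ projections H ∧ HaveCommonComplement p.1.range p.2.range}

/-- Pairs of orthogonal projections whose ranges do not have a common complement. -/
def Gamma (H : Type*) [NormedAddCommGroup H] [InnerProductSpace ℂ H] [CompleteSpace H] :
    Set ((H →L[ℂ] H) × (H →L[ℂ] H)) :=
  {p | p.1 ∈ projections H ∧ p.2 ∈ projections H ∧ ¬ HaveCommonComplement p.1.range p.2.range}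

/-! ### The restricted Grassmannian -/

/-- The operator `Q|_{R(P)} : R(P) → R(Q)`. -/
def pairOperator (P Q : H →L[ℂ] H) : P.range →L[ℂ] Q.range :=
  Q.rangeRestrict ∘L P.range.subtypeL

/-- The index `dim ker T - dim coker T` of an operator (used for Fredholm operators, where both
dimensions are finite). -/
def fredholmIndex {E F : Type*} [NormedAddCommGroup E] [NormedSpace ℂ E]
    [NormedAddCommGroup F] [NormedSpace ℂ F] (T : E →L[ℂ] F) : ℤ :=
  (Module.finrank ℂ T.ker : ℤ) - (Module.finrank ℂ (F ⧸ T.range) : ℤ)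

/-- The index of a (Fredholm) pair of projections. -/
def pairIndex (P Q : H →L[ℂ] H) : ℤ := fredholmIndex (pairOperator P Q)

/-- The restricted Grassmannian relative to the projection `Pplus`. -/
def GrRes (Pplus : H →L[ℂ] H) : Set (H →L[ℂ] H) :=
  {P | P ∈ projections H ∧ IsCompactOperator (P - Pplus)}

/-- The part of index `k` of the restricted Grassmannian. Compactness of `P - Pplus` makes
`(Pplus, P)` a Fredholm pair, so the index is the genuine one. -/
def GrResComp (Pplus : H →L[ℂ] H) (k : ℤ) : Set (H →L[ℂ] H) :=
  {P | P ∈ GrRes Pplus ∧ pairIndex Pplus P = k}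

/-! ### Geodesics and length -/

/-- The idempotent of `B(H)` onto the tangent space of `P(H)` at `P`. -/
def tangentProj (P X : H →L[ℂ] H) : H →L[ℂ] H :=
  P * X * (1 - P) + (1 - P) * X * P

/-- The covariant derivative `DX/dt = E_γ(Ẋ)` of a field `X` along a curve `γ` on `[0, 1]`. -/
def covDeriv (γ X : ℝ → (H →L[ℂ] H)) (t : ℝ) : H →L[ℂ] H :=
  tangentProj (γ t) (derivWithin X (Icc 0 1) t)

/-- `δ : [0, 1] → P(H)` is a geodesic: a smooth curve in `P(H)` whose velocity is parallel. -/
def IsGeodesic (δ : ℝ → (H →L[ℂ] H)) : Prop :=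
  ContDiffOn ℝ ∞ δ (Icc 0 1) ∧ (∀ t ∈ Icc (0 : ℝ) 1, δ t ∈ projections H) ∧
    ∀ t ∈ Icc (0 : ℝ) 1, covDeriv δ (derivWithin δ (Icc 0 1)) t = 0

/-- Piecewise `C¹` curves on `[0, 1]`: `C¹` on each closed interval of a finite partition. -/
def IsPiecewiseC1 {E : Type*} [NormedAddCommGroup E] [NormedSpace ℝ E] (γ : ℝ → E) : Prop :=
  ∃ (n : ℕ) (s : Fin (n + 1) → ℝ), StrictMono s ∧ s 0 = 0 ∧ s (Fin.last n) = 1 ∧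
    ∀ i : Fin n, ContDiffOn ℝ 1 γ (Icc (s i.castSucc) (s i.succ))

/-- The length of a piecewise `C¹` curve in `P(H) × P(H)` for the product Finsler metric. -/
def curveLength (γ : ℝ → (H →L[ℂ] H) × (H →L[ℂ] H)) : ℝ :=
  ∫ t in (0 : ℝ)..1,
    Real.sqrt (‖deriv (fun s => (γ s).1) t‖ ^ 2 + ‖deriv (fun s => (γ s).2) t‖ ^ 2)

/-- `δ : [0, 1] → P(H) × P(H)` is a minimizing geodesic: a geodesic of the product, not longer
than any piecewise `C¹` curve in `P(H) × P(H)` with the same endpoints. -/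
def IsMinimizingGeodesic (δ : ℝ → (H →L[ℂ] H) × (H →L[ℂ] H)) : Prop :=
  IsGeodesic (fun t => (δ t).1) ∧ IsGeodesic (fun t => (δ t).2) ∧
    ∀ γ : ℝ → (H →L[ℂ] H) × (H →L[ℂ] H), IsPiecewiseC1 γ →
      (∀ t ∈ Icc (0 : ℝ) 1, γ t ∈ projections H ×ˢ projections H) →
      γ 0 = δ 0 → γ 1 = δ 1 → curveLength δ ≤ curveLength γ

/-- There is a minimizing geodesic of `P(H) × P(H)` from `a` to `b` contained in `A`. -/
def JoinedByMinimizingGeodesicIn (A : Set ((H →L[ℂ] H) × (H →L[ℂ] H)))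
    (a b : (H →L[ℂ] H) × (H →L[ℂ] H)) : Prop :=
  ∃ δ : ℝ → (H →L[ℂ] H) × (H →L[ℂ] H), IsMinimizingGeodesic δ ∧ δ 0 = a ∧ δ 1 = b ∧
    ∀ t ∈ Icc (0 : ℝ) 1, δ t ∈ A

end CommonComplement

end

/-!
Composing the operators `R(A) → R(B) → R(C) → R(A)` of projections with compact differences gives a
compact perturbation of the identity, whose index is `0`; hence `pairIndex` is additive. If `Z` is a
common complement of `R(P)` and `R(Q)`, the projection onto `R(P)` along `Z` restricts to an
isomorphism `R(Q) ≃ R(P)` whose composite with `Q|_{R(P)}` is again a compact perturbation of the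
identity, so `pairIndex P Q = 0`. This gives the inclusion in `Gamma`.

Let `S_P = 2P - 1`. If `P - Q` is compact of index `0`, there is a compact self-adjoint `Y`
anticommuting with `S_P`, with `‖Y‖ ≤ π` and `exp (iY) S_P = S_Q`. When `‖P - Q‖ < 1` it is the
logarithm of `S_Q S_P`; in general `-1` may be an eigenvalue of `S_Q S_P`, on
`ker (P + Q - 1) = (R(P) ∩ N(Q)) ⊕ (N(P) ∩ R(Q))`. Index `0` says that the two summands have equal
finite dimension, so that they can be exchanged by a unitary `J`, and one adds `πJ` to the logarithm
on the complement. The curve `t ↦ (1 + exp (itY) S_P) / 2` is then a geodesic from `P` to `Q` of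
constant speed `‖Y‖ / 2 ≤ π / 2`. Hence its midpoint is at distance `≤ π / 4 < 1` from `P` and from
`Q`, and the nullspace of the midpoint is a common complement of `R(P)` and `R(Q)`. The same holds
for `P` and each point of the geodesic, which therefore keeps the index of `P`.

For minimality, let `v` be a unit eigenvector of `Y` for an eigenvalue `± ‖Y‖`. For any curve `γ`
from `P` to `Q`, the vector `S_{γ(t)} v` runs on the unit sphere at speed at most `2 ‖γ'‖`, while
`S_Q v = exp (iY) S_P v` makes the angle `‖Y‖` with `S_P v`; so `γ` has length at least `‖Y‖ / 2`.
The product follows, since `(∫ f)² + (∫ g)² ≤ (∫ √(f² + g²))²`.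
-/

noncomputable section

namespace CommonComplement

/-! ### Fredholm operators and compact perturbations of the identity -/

section Index

variable {k V W : Type*} [Field k] [AddCommGroup V] [Module k V] [AddCommGroup W] [Module k W]

open scoped LinearMap.FiniteRangeSetoid

theorem index_congr_of_finiteRange {u v : V →ₗ[k] W} [FiniteDimensional k u.ker]
    [FiniteDimensional k v.ker] [FiniteDimensional k (W ⧸ u.range)]
    [FiniteDimensional k (W ⧸ v.range)] (huv : u ≈ v) : u.index = v.index := by
  -- Both maps restrict to the same map on the finite-codimensional subspace where they agree.
  let ι := (LinearMap.eqLocus u v).subtype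
  have hcomp : u ∘ₗ ι = v ∘ₗ ι := LinearMap.ext fun x => x.2
  have : FiniteDimensional k (V ⧸ ι.range) := by
    rw [Submodule.range_subtype]
    exact LinearMap.FiniteRangeSetoid.equiv_iff_eqLocus_coFG.1 huv
  have : FiniteDimensional k ι.ker := by
    rw [Submodule.ker_subtype]
    infer_instance
  have hu := LinearMap.index_comp (f := ι) u
  rw [hcomp, LinearMap.index_comp] at hu
  exact (add_right_cancel hu).symm

end Index

section IsFredholm

variable {𝕜 E F G : Type*} [NontriviallyNormedField 𝕜]
  [NormedAddCommGroup E] [NormedSpace 𝕜 E] [NormedAddCommGroup F] [NormedSpace 𝕜 F]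
  [NormedAddCommGroup G] [NormedSpace 𝕜 G]

theorem index_comp_of_isFredholm {S : F →L[𝕜] G} {T : E →L[𝕜] F} (hS : S.IsFredholm)
    (hT : T.IsFredholm) :
    (S ∘L T).toLinearMap.index = S.toLinearMap.index + T.toLinearMap.index :=
  have := hS.finite_ker
  have := hS.finite_coker
  have := hT.finite_ker
  have := hT.finite_coker
  LinearMap.index_comp _

variable [CompleteSpace 𝕜]

theorem isFredholm_comp {S : F →L[𝕜] G} {T : E →L[𝕜] F} (hS : S.IsFredholm)
    (hT : T.IsFredholm) : (S ∘L T).IsFredholm := by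
  obtain ⟨S', hS'⟩ := hS.exists_isQuasiInverse
  obtain ⟨T', hT'⟩ := hT.exists_isQuasiInverse
  exact .of_isQuasiInverse (v := T' ∘L S') (hT'.comp hS')

theorem isFredholm_of_comp_comp {S : F →L[𝕜] E} {T : E →L[𝕜] F} (hST : (S ∘L T).IsFredholm)
    (hTS : (T ∘L S).IsFredholm) : T.IsFredholm := by
  obtain ⟨v, hv⟩ := hST.exists_isQuasiInverse
  obtain ⟨w, hw⟩ := hTS.exists_isQuasiInverse
  have hwT : (w ∘L T).toLinearMap.IsLeftQuasiInverse S.toLinearMap := hw.1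
  exact .of_isQuasiInverse (v := v ∘L S) ⟨hv.1, .of_comp_right hwT hv.2⟩

end IsFredholm

section CompactPerturbation

open scoped LinearMap.FiniteRangeSetoid

variable {𝕜 E : Type*} [RCLike 𝕜] [NormedAddCommGroup E] [InnerProductSpace 𝕜 E]

theorem exists_finiteRange_norm_sub_le {K : E →L[𝕜] E} (hK : IsCompactOperator K)
    {ε : ℝ} (hε : 0 < ε) :
    ∃ F : E →L[𝕜] E, F.toLinearMap.HasFiniteRange ∧ ‖K - F‖ ≤ ε := by
  have htb : TotallyBounded (K '' Metric.closedBall 0 1) :=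
    (hK.isCompact_closure_image_closedBall (f := K.toLinearMap) 1).totallyBounded.subset
      subset_closure
  obtain ⟨t, ht, hcover⟩ := Metric.totallyBounded_iff.1 htb ε hε
  let W : Submodule 𝕜 E := Submodule.span 𝕜 t
  have : FiniteDimensional 𝕜 W := FiniteDimensional.span_of_finite 𝕜 ht
  refine ⟨W.starProjection ∘L K, ?_, ?_⟩
  · have hle : (W.starProjection ∘L K).range ≤ W := by
      rintro _ ⟨x, rfl⟩
      exact Submodule.starProjection_apply_mem _ _
    exact Module.Finite.iff_fg.1 (Submodule.finiteDimensional_of_le hle)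
  · refine ContinuousLinearMap.opNorm_le_of_unit_norm hε.le fun x hx => ?_
    obtain ⟨y, hy, hxy⟩ := mem_iUnion₂.1 (hcover ⟨x, by simp [hx], rfl⟩)
    calc ‖K x - W.starProjection (K x)‖ = ⨅ w : W, ‖K x - w‖ := Submodule.starProjection_minimal _
      _ ≤ ‖K x - y‖ := ciInf_le ⟨0, by rintro _ ⟨z, rfl⟩; positivity⟩
          (⟨y, Submodule.subset_span hy⟩ : W)
      _ ≤ ε := (dist_eq_norm (K x) y).symm.trans_le (Metric.mem_ball.1 hxy).le

variable [CompleteSpace E]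

theorem exists_equiv_one_add_of_isCompactOperator {K : E →L[𝕜] E} (hK : IsCompactOperator K) :
    ∃ e : E ≃L[𝕜] E, (1 + K).toLinearMap ≈ e.toLinearEquiv.toLinearMap := by
  obtain ⟨F, hF, hKF⟩ := exists_finiteRange_norm_sub_le hK one_half_pos
  have hnorm : ‖-(K - F)‖ < 1 := by
    rw [norm_neg]
    linarith
  let e : E ≃L[𝕜] E := ContinuousLinearEquiv.ofUnit (Units.oneSub _ hnorm)
  refine ⟨e, LinearMap.FiniteRangeSetoid.equiv_iff_hasFiniteRange.2 ?_⟩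
  suffices hsub : (1 + K).toLinearMap - e.toLinearEquiv.toLinearMap = F.toLinearMap by rwa [hsub]
  ext x
  change x + K x - (x - -(K x - F x)) = F x
  abel

theorem isFredholm_one_add_of_isCompactOperator {K : E →L[𝕜] E} (hK : IsCompactOperator K) :
    (1 + K).IsFredholm := by
  obtain ⟨e, he⟩ := exists_equiv_one_add_of_isCompactOperator hK
  exact .of_isQuasiInverse (v := e.symm.toContinuousLinearMap)
    (e.toLinearEquiv.isQuasiInverse.congr (Setoid.refl _) he)

theorem index_one_add_of_isCompactOperator {K : E →L[𝕜] E} (hK : IsCompactOperator K) :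
    (1 + K).toLinearMap.index = 0 := by
  obtain ⟨e, he⟩ := exists_equiv_one_add_of_isCompactOperator hK
  have := (isFredholm_one_add_of_isCompactOperator hK).finite_ker
  have := (isFredholm_one_add_of_isCompactOperator hK).finite_coker
  have : FiniteDimensional 𝕜 e.toLinearEquiv.toLinearMap.ker := by
    rw [LinearEquiv.ker]
    infer_instance
  have : FiniteDimensional 𝕜 (E ⧸ e.toLinearEquiv.toLinearMap.range) := by
    rw [LinearEquiv.range]
    infer_instance
  rw [index_congr_of_finiteRange he, LinearEquiv.index_eq_zero]

end CompactPerturbation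

section Adjoint

variable {𝕜 E F : Type*} [RCLike 𝕜] [NormedAddCommGroup E] [InnerProductSpace 𝕜 E]
  [CompleteSpace E] [NormedAddCommGroup F] [InnerProductSpace 𝕜 F] [CompleteSpace F]

theorem index_eq_finrank_ker_sub_finrank_ker_adjoint {T : E →L[𝕜] F} (hT : T.IsFredholm) :
    T.toLinearMap.index = (Module.finrank 𝕜 T.ker : ℤ) - Module.finrank 𝕜 T.adjoint.ker := by
  have := hT.isClosed_range.completeSpace_coe
  have hcoker := Submodule.quotientEquivOfIsCompl T.range T.rangeᗮ T.range.isCompl_orthogonal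
  rw [LinearMap.index_eq_finrank_sub, hcoker.finrank_eq, ContinuousLinearMap.orthogonal_range]

end Adjoint

/-! ### Fredholm pairs of projections -/

section FredholmPair

variable {H : Type*} [NormedAddCommGroup H] [InnerProductSpace ℂ H]

theorem isCompactOperator_sub_comm {A B : H →L[ℂ] H} (h : IsCompactOperator (A - B)) :
    IsCompactOperator (B - A) := by
  rw [← neg_sub]
  exact h.neg

theorem isCompactOperator_sub_trans {A B C : H →L[ℂ] H} (hAB : IsCompactOperator (A - B))
    (hBC : IsCompactOperator (B - C)) : IsCompactOperator (A - C) := by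
  rw [← sub_add_sub_cancel A B C]
  exact hAB.add hBC

theorem apply_eq_self_of_mem_range {A : H →L[ℂ] H} (hA : IsIdempotentElem A) {x : H}
    (hx : x ∈ A.range) : A x = x :=
  (LinearMap.IsIdempotentElem.mem_range_iff
    (ContinuousLinearMap.isIdempotentElem_toLinearMap_iff.2 hA)).1 hx

/-- The compression `A K|_{R(A)} : R(A) → R(A)` of an operator `K` to the range of `A`. -/
def compression (A K : H →L[ℂ] H) : A.range →L[ℂ] A.range :=
  A.rangeRestrict ∘L K ∘L A.range.subtypeL

theorem isCompactOperator_compression (A : H →L[ℂ] H) {K : H →L[ℂ] H} (hK : IsCompactOperator K) :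
    IsCompactOperator (compression A K) :=
  (hK.comp_clm A.range.subtypeL).clm_comp A.rangeRestrict

theorem pairOperator_self {A : H →L[ℂ] H} (hA : IsIdempotentElem A) : pairOperator A A = 1 :=
  ContinuousLinearMap.ext fun x => Subtype.ext (apply_eq_self_of_mem_range hA x.2)

theorem pairIndex_self {A : H →L[ℂ] H} (hA : IsIdempotentElem A) : pairIndex A A = 0 := by
  rw [pairIndex, pairOperator_self hA]
  exact LinearMap.index_id

theorem exists_isCompactOperator_pairOperator_cycle {A B C : H →L[ℂ] H} (hA : IsIdempotentElem A)
    (hAB : IsCompactOperator (A - B)) (hAC : IsCompactOperator (A - C)) :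
    ∃ K : A.range →L[ℂ] A.range, IsCompactOperator K ∧
      pairOperator C A ∘L pairOperator B C ∘L pairOperator A B = 1 + K := by
  refine ⟨compression A ((C - A) ∘L B + (B - A)), isCompactOperator_compression A
    (((isCompactOperator_sub_comm hAC).comp_clm B).add (isCompactOperator_sub_comm hAB)), ?_⟩
  ext x
  have hx : A x = x := apply_eq_self_of_mem_range hA x.2
  have hABx : A (A (B x)) = A (B x) := apply_eq_self_of_mem_range hA ⟨B x, rfl⟩
  change A (C (B x)) = x + A (C (B x) - A (B x) + (B x - A x))
  rw [hx, map_add, map_sub, map_sub, hABx, hx]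
  abel

theorem map_ker_pairOperator (P Q : H →L[ℂ] H) :
    (pairOperator P Q).ker.map P.range.subtype = P.range ⊓ Q.ker := by
  ext x
  constructor
  · rintro ⟨y, hy, rfl⟩
    exact ⟨y.2, congrArg Subtype.val hy⟩
  · rintro ⟨hxP, hxQ⟩
    exact ⟨⟨x, hxP⟩, Subtype.ext hxQ, rfl⟩

variable [CompleteSpace H]

theorem completeSpace_range {A : H →L[ℂ] H} (hA : IsIdempotentElem A) : CompleteSpace A.range :=
  (ContinuousLinearMap.IsIdempotentElem.isClosed_range hA).completeSpace_coe

theorem isFredholm_pairOperator_cycle {A B C : H →L[ℂ] H} (hA : IsIdempotentElem A)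
    (hAB : IsCompactOperator (A - B)) (hAC : IsCompactOperator (A - C)) :
    (pairOperator C A ∘L pairOperator B C ∘L pairOperator A B).IsFredholm := by
  have := completeSpace_range hA
  obtain ⟨K, hK, hcycle⟩ := exists_isCompactOperator_pairOperator_cycle hA hAB hAC
  exact hcycle ▸ isFredholm_one_add_of_isCompactOperator hK

theorem index_pairOperator_cycle {A B C : H →L[ℂ] H} (hA : IsIdempotentElem A)
    (hAB : IsCompactOperator (A - B)) (hAC : IsCompactOperator (A - C)) :
    (pairOperator C A ∘L pairOperator B C ∘L pairOperator A B).toLinearMap.index = 0 := by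
  have := completeSpace_range hA
  obtain ⟨K, hK, hcycle⟩ := exists_isCompactOperator_pairOperator_cycle hA hAB hAC
  exact hcycle ▸ index_one_add_of_isCompactOperator hK

theorem isFredholm_pairOperator {A B : H →L[ℂ] H} (hA : IsIdempotentElem A)
    (hB : IsIdempotentElem B) (hAB : IsCompactOperator (A - B)) :
    (pairOperator A B).IsFredholm := by
  have hBA := isCompactOperator_sub_comm hAB
  have hleft := isFredholm_pairOperator_cycle hA hAB hAB
  have hright := isFredholm_pairOperator_cycle hB hBA hBA
  rw [pairOperator_self hB] at hleft
  rw [pairOperator_self hA] at hright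
  exact isFredholm_of_comp_comp hleft hright

theorem pairIndex_cyclic_sum {A B C : H →L[ℂ] H} (hA : IsIdempotentElem A)
    (hB : IsIdempotentElem B) (hC : IsIdempotentElem C) (hAB : IsCompactOperator (A - B))
    (hAC : IsCompactOperator (A - C)) :
    pairIndex A B + pairIndex B C + pairIndex C A = 0 := by
  have hBC := isCompactOperator_sub_trans (isCompactOperator_sub_comm hAB) hAC
  have hT := isFredholm_pairOperator hA hB hAB
  have hS := isFredholm_pairOperator hB hC hBC
  have hR := isFredholm_pairOperator hC hA (isCompactOperator_sub_comm hAC)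
  have hcycle := index_pairOperator_cycle hA hAB hAC
  rw [index_comp_of_isFredholm hR (isFredholm_comp hS hT), index_comp_of_isFredholm hS hT]
    at hcycle
  change pairIndex C A + (pairIndex B C + pairIndex A B) = 0 at hcycle
  linarith

theorem pairIndex_swap {A B : H →L[ℂ] H} (hA : IsIdempotentElem A) (hB : IsIdempotentElem B)
    (hAB : IsCompactOperator (A - B)) : pairIndex B A = -pairIndex A B := by
  have hcyclic := pairIndex_cyclic_sum hA hB hB hAB hAB
  rw [pairIndex_self hB, add_zero] at hcyclic
  exact eq_neg_of_add_eq_zero_right hcyclic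

theorem pairIndex_eq_sub {A B C : H →L[ℂ] H} (hA : IsIdempotentElem A)
    (hB : IsIdempotentElem B) (hC : IsIdempotentElem C) (hAB : IsCompactOperator (A - B))
    (hAC : IsCompactOperator (A - C)) : pairIndex B C = pairIndex A C - pairIndex A B := by
  have hcyclic := pairIndex_cyclic_sum hA hB hC hAB hAC
  rw [pairIndex_swap hA hC hAC] at hcyclic
  linarith

theorem adjoint_pairOperator {P Q : H →L[ℂ] H} (hP : IsStarProjection P) (hQ : IsStarProjection Q)
    [CompleteSpace P.range] [CompleteSpace Q.range] :
    (pairOperator P Q).adjoint = pairOperator Q P := by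
  refine ((ContinuousLinearMap.eq_adjoint_iff _ _).2 fun y x => ?_).symm
  have hx : P x = x := apply_eq_self_of_mem_range hP.isIdempotentElem x.2
  have hy : Q y = y := apply_eq_self_of_mem_range hQ.isIdempotentElem y.2
  change inner ℂ (P y) (x : H) = inner ℂ (y : H) (Q x)
  calc inner ℂ (P y) (x : H) = inner ℂ (y : H) (P x) := hP.isSelfAdjoint.isSymmetric y x
    _ = inner ℂ (Q y) (x : H) := by rw [hx, hy]
    _ = inner ℂ (y : H) (Q x) := hQ.isSelfAdjoint.isSymmetric y x

theorem finiteDimensional_range_inf_ker {P Q : H →L[ℂ] H} (hP : IsIdempotentElem P)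
    (hQ : IsIdempotentElem Q) (hPQ : IsCompactOperator (P - Q)) :
    FiniteDimensional ℂ (P.range ⊓ Q.ker : Submodule ℂ H) := by
  have := (isFredholm_pairOperator hP hQ hPQ).finite_ker
  rw [← map_ker_pairOperator]
  infer_instance

theorem pairIndex_eq_finrank_sub {P Q : H →L[ℂ] H} (hP : IsStarProjection P)
    (hQ : IsStarProjection Q) (hPQ : IsCompactOperator (P - Q)) :
    pairIndex P Q = (Module.finrank ℂ (P.range ⊓ Q.ker : Submodule ℂ H) : ℤ) -
      Module.finrank ℂ (Q.range ⊓ P.ker : Submodule ℂ H) := by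
  have := completeSpace_range hP.isIdempotentElem
  have := completeSpace_range hQ.isIdempotentElem
  rw [← map_ker_pairOperator, ← map_ker_pairOperator, Submodule.finrank_map_subtype_eq,
    Submodule.finrank_map_subtype_eq, ← adjoint_pairOperator hP hQ]
  exact index_eq_finrank_ker_sub_finrank_ker_adjoint
    (isFredholm_pairOperator hP.isIdempotentElem hQ.isIdempotentElem hPQ)

end FredholmPair

/-! ### Common complements -/

theorem bijective_projectionOnto_comp_subtype {𝕜 E : Type*} [Ring 𝕜] [AddCommGroup E]
    [Module 𝕜 E] {S T Z : Submodule 𝕜 E} (hS : IsCompl S Z) (hT : IsCompl T Z) :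
    Function.Bijective (S.projectionOnto Z hS ∘ₗ T.subtype) := by
  constructor
  · rw [← LinearMap.ker_eq_bot, LinearMap.ker_comp, Submodule.ker_projectionOnto]
    exact Submodule.disjoint_iff_comap_eq_bot.1 hT.disjoint
  · intro y
    obtain ⟨t, ht, z, hz, htz⟩ := Submodule.mem_sup.1
      (hT.sup_eq_top.symm ▸ Submodule.mem_top : (y : E) ∈ T ⊔ Z)
    refine ⟨⟨t, ht⟩, ?_⟩
    rw [← Submodule.projectionOnto_apply_left hS y, ← htz, map_add,
      (Submodule.projectionOnto_apply_eq_zero_iff hS).2 hz, add_zero]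
    rfl

theorem index_comp_linearEquiv {R M N L : Type*} [Ring R] [AddCommGroup M] [AddCommGroup N]
    [AddCommGroup L] [Module R M] [Module R N] [Module R L] (e : M ≃ₗ[R] N) (g : N →ₗ[R] L) :
    (g ∘ₗ e.toLinearMap).index = g.index := by
  rw [LinearMap.index, LinearMap.index, LinearMap.range_comp_of_range_eq_top _ e.range,
    LinearMap.ker_comp, (LinearEquiv.ofSubmodule' e g.ker).finrank_eq]

section CommonComplements

variable {H : Type*} [NormedAddCommGroup H] [InnerProductSpace ℂ H] [CompleteSpace H]

theorem pairIndex_eq_zero_of_haveCommonComplement {P Q : H →L[ℂ] H} (hP : IsIdempotentElem P)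
    (hQ : IsIdempotentElem Q) (hPQ : IsCompactOperator (P - Q))
    (hcompl : HaveCommonComplement P.range Q.range) : pairIndex P Q = 0 := by
  obtain ⟨Z, hZ, hPZ, hQZ⟩ := hcompl
  have := completeSpace_range hQ
  have hPcl := ContinuousLinearMap.IsIdempotentElem.isClosed_range hP
  let p : H →L[ℂ] P.range :=
    P.range.projectionOntoL Z (Submodule.IsCompl.isTopCompl_of_isClosed hPZ hPcl hZ)
  have hp (x : P.range) : p x = x := Submodule.projectionOnto_apply_left hPZ x
  let e : Q.range ≃ₗ[ℂ] P.range :=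
    LinearEquiv.ofBijective _ (bijective_projectionOnto_comp_subtype hPZ hQZ)
  let D : H →L[ℂ] H := P.range.subtypeL ∘L p - 1
  have hK : IsCompactOperator (D ∘L (Q - P)) := (isCompactOperator_sub_comm hPQ).clm_comp D
  have hfactor : (pairOperator P Q).toLinearMap ∘ₗ e.toLinearMap =
      (1 + compression Q (D ∘L (Q - P)) : Q.range →L[ℂ] Q.range).toLinearMap := by
    ext x
    have hx : Q x = x := apply_eq_self_of_mem_range hQ x.2
    have hpP : (p (P x) : H) = P x := congrArg Subtype.val (hp ⟨P x, x, rfl⟩)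
    change Q (p x : H) = x + Q ((p (Q x - P x) : H) - (Q x - P x))
    rw [map_sub p, hx, Submodule.coe_sub, hpP, map_sub Q, map_sub Q, map_sub Q, hx]
    abel
  calc pairIndex P Q = ((pairOperator P Q).toLinearMap ∘ₗ e.toLinearMap).index :=
        (index_comp_linearEquiv e _).symm
    _ = 0 := by
      rw [hfactor]
      exact index_one_add_of_isCompactOperator (isCompactOperator_compression Q hK)

theorem isCompl_range_ker_of_norm_sub_lt_one {P M : H →L[ℂ] H} (hP : IsIdempotentElem P)
    (hM : IsIdempotentElem M) (hPM : ‖P - M‖ < 1) : IsCompl P.range M.ker := by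
  constructor
  · refine Submodule.disjoint_def.2 fun x hxP hxM => ?_
    have hfix : (P - M) x = x := by
      change P x - M x = x
      rw [apply_eq_self_of_mem_range hP hxP, show M x = 0 from hxM, sub_zero]
    have hle := (P - M).le_opNorm x
    rw [hfix] at hle
    by_contra hne
    nlinarith [norm_pos_iff.2 hne]
  · refine codisjoint_iff.2 (eq_top_iff.2 fun y _ => ?_)
    let u : (H →L[ℂ] H)ˣ := Units.oneSub (M - P) (by rwa [norm_sub_rev])
    obtain ⟨z, rfl⟩ : ∃ z, z - (M z - P z) = y :=
      ⟨(↑u⁻¹ : H →L[ℂ] H) y, congrArg (fun T : H →L[ℂ] H => T y) u.mul_inv⟩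
    refine Submodule.mem_sup.2 ⟨P z, ⟨z, rfl⟩, z - M z, ?_, by abel⟩
    have hMMz : M (M z) = M z := apply_eq_self_of_mem_range hM ⟨z, rfl⟩
    exact (map_sub M z (M z)).trans (sub_eq_zero.2 hMMz.symm)

theorem haveCommonComplement_of_norm_sub_lt_one {P Q M : H →L[ℂ] H} (hP : IsIdempotentElem P)
    (hQ : IsIdempotentElem Q) (hM : IsIdempotentElem M) (hPM : ‖P - M‖ < 1)
    (hQM : ‖Q - M‖ < 1) : HaveCommonComplement P.range Q.range :=
  ⟨M.ker, M.isClosed_ker, isCompl_range_ker_of_norm_sub_lt_one hP hM hPM,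
    isCompl_range_ker_of_norm_sub_lt_one hQ hM hQM⟩

end CommonComplements

/-! ### One-parameter geodesics -/

section Symmetry

variable {A : Type*} [Ring A]

/-- The symmetry `2p - 1` attached to an idempotent `p`, written `ε_p` in the literature. -/
def symmetry (p : A) : A := 2 * p - 1

theorem symmetry_mul_symmetry_self {p : A} (hp : IsIdempotentElem p) :
    symmetry p * symmetry p = 1 := by
  calc (2 * p - 1) * (2 * p - 1) = 4 * (p * p - p) + 1 := by noncomm_ring
    _ = 1 := by rw [hp.eq, sub_self, mul_zero, zero_add]

theorem commute_symmetry_right {x p : A} (h : Commute x p) : Commute x (symmetry p) :=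
  ((Commute.ofNat_right x 2).mul_right h).sub_right (Commute.one_right x)

theorem isSelfAdjoint_symmetry [StarRing A] {p : A} (hp : IsSelfAdjoint p) :
    IsSelfAdjoint (symmetry p) := by
  rw [symmetry, two_mul]
  exact (hp.add hp).sub (.one A)

theorem symmetry_mem_unitary [StarRing A] {p : A} (hp : IsStarProjection p) :
    symmetry p ∈ unitary A :=
  hp.two_mul_sub_one_mem_unitary

theorem symmetry_half_smul [Module ℂ A] (s : A) : symmetry ((1 / 2 : ℂ) • (1 + s)) = s := by
  rw [symmetry, two_mul, ← add_smul]
  norm_num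

theorem half_smul_symmetry [Module ℂ A] (p : A) : (1 / 2 : ℂ) • (1 + symmetry p) = p := by
  rw [symmetry, add_sub_cancel, two_mul, ← two_smul ℂ, smul_smul]
  norm_num

end Symmetry

/-- Self-adjoint elements that are off-diagonal with respect to `p`: these are the elements whose
multiples by `i` form the tangent directions at `p` of the Grassmannian, as unitary orbit. -/
structure IsCodiagonal {A : Type*} [Ring A] [StarRing A] (p y : A) : Prop where
  isSelfAdjoint : IsSelfAdjoint y
  symmetry_mul : symmetry p * y = -(y * symmetry p)

section Geodesic

variable {A : Type*} [CStarAlgebra A]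

theorem isStarProjection_half_smul {s : A} (hs : IsSelfAdjoint s) (hss : s * s = 1) :
    IsStarProjection ((1 / 2 : ℂ) • (1 + s)) := by
  constructor
  · change _ * _ = _
    simp only [smul_mul_smul_comm, mul_add, add_mul, mul_one, one_mul, hss]
    module
  · change star _ = _
    rw [star_smul, star_add, star_one, hs.star_eq]
    simp

theorem semiconjBy_exp {x a b : A} (h : SemiconjBy x a b) :
    SemiconjBy x (NormedSpace.exp a) (NormedSpace.exp b) :=
  let +nondep : NormedAlgebra ℚ A := .restrictScalars ℚ ℂ A
  h.exp_right

theorem exp_mul_exp_neg (x : A) : NormedSpace.exp x * NormedSpace.exp (-x) = 1 := by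
  let +nondep : NormedAlgebra ℚ A := .restrictScalars ℚ ℂ A
  rw [← NormedSpace.exp_add_of_commute (Commute.refl x).neg_right, add_neg_cancel,
    NormedSpace.exp_zero]

theorem star_exp_I_smul {y : A} (hy : IsSelfAdjoint y) :
    star (NormedSpace.exp (Complex.I • y)) = NormedSpace.exp (-(Complex.I • y)) := by
  rw [NormedSpace.star_exp, star_smul, hy.star_eq]
  simp

namespace IsCodiagonal

variable {p y : A}

theorem real_smul (hy : IsCodiagonal p y) (t : ℝ) : IsCodiagonal p (t • y) where
  isSelfAdjoint := (IsSelfAdjoint.all t).smul hy.isSelfAdjoint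
  symmetry_mul := by rw [mul_smul_comm, hy.symmetry_mul, smul_neg, smul_mul_assoc]

theorem symmetry_mul_exp (hy : IsCodiagonal p y) :
    symmetry p * NormedSpace.exp (-(Complex.I • y)) =
      NormedSpace.exp (Complex.I • y) * symmetry p := by
  refine semiconjBy_exp ?_
  change _ * _ = _ * _
  rw [mul_neg, mul_smul_comm, hy.symmetry_mul, smul_neg, neg_neg, smul_mul_assoc]

theorem isSelfAdjoint_exp_mul_symmetry (hp : IsSelfAdjoint p) (hy : IsCodiagonal p y) :
    IsSelfAdjoint (NormedSpace.exp (Complex.I • y) * symmetry p) := by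
  rw [IsSelfAdjoint, star_mul, (isSelfAdjoint_symmetry hp).star_eq,
    star_exp_I_smul hy.isSelfAdjoint, hy.symmetry_mul_exp]

theorem exp_mul_symmetry_mul_self (hp : IsIdempotentElem p) (hy : IsCodiagonal p y) :
    NormedSpace.exp (Complex.I • y) * symmetry p *
      (NormedSpace.exp (Complex.I • y) * symmetry p) = 1 := by
  nth_rewrite 2 [← hy.symmetry_mul_exp]
  rw [mul_assoc, ← mul_assoc (symmetry p), symmetry_mul_symmetry_self hp, one_mul,
    exp_mul_exp_neg]

end IsCodiagonal

/-- The curve of projections whose symmetry at time `t` is `e^{ity} ε_p`, that is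
`t ↦ e^{ity/2} p e^{-ity/2}`, for `y` codiagonal with respect to `p`. -/
def geodesicOf (p y : A) (t : ℝ) : A :=
  (1 / 2 : ℂ) • (1 + NormedSpace.exp (Complex.I • t • y) * symmetry p)

theorem symmetry_geodesicOf (p y : A) (t : ℝ) :
    symmetry (geodesicOf p y t) = NormedSpace.exp (Complex.I • t • y) * symmetry p :=
  symmetry_half_smul _

theorem geodesicOf_zero (p y : A) : geodesicOf p y 0 = p := by
  rw [geodesicOf, zero_smul, smul_zero, NormedSpace.exp_zero, one_mul, half_smul_symmetry]

theorem geodesicOf_one {p q y : A}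
    (h : NormedSpace.exp (Complex.I • y) * symmetry p = symmetry q) : geodesicOf p y 1 = q := by
  rw [geodesicOf, one_smul, h, half_smul_symmetry]

theorem hasDerivAt_geodesicOf (p y : A) (t : ℝ) :
    HasDerivAt (geodesicOf p y) ((Complex.I / 2) • (y * symmetry (geodesicOf p y t))) t := by
  have hexp : HasDerivAt (fun t : ℝ => NormedSpace.exp (Complex.I • t • y))
      (Complex.I • (y * NormedSpace.exp (Complex.I • t • y))) t := by
    simp only [smul_comm Complex.I]
    rw [← smul_mul_assoc]
    exact hasDerivAt_exp_smul_const' (𝕂 := ℝ) (Complex.I • y) t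
  refine (((hexp.mul_const (symmetry p)).const_add 1).const_smul (1 / 2 : ℂ)).congr_deriv ?_
  rw [symmetry_geodesicOf, smul_mul_assoc, mul_assoc, smul_smul, one_div_mul_eq_div]

theorem contDiff_geodesicOf (p y : A) : ContDiff ℝ ∞ (geodesicOf p y) := by
  have hexp : ContDiff ℝ ∞ (NormedSpace.exp : A → A) :=
    AnalyticOnNhd.contDiff fun x _ => NormedSpace.exp_analytic (𝕂 := ℝ) x
  have hcurve : ContDiff ℝ ∞ fun t : ℝ => NormedSpace.exp (Complex.I • t • y) :=
    hexp.comp ((contDiff_id.smul contDiff_const).const_smul Complex.I)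
  exact (contDiff_const.add (hcurve.mul contDiff_const)).const_smul (1 / 2 : ℂ)

theorem hasDerivAt_symmetry {γ : ℝ → A} {γ' : A} {t : ℝ} (h : HasDerivAt γ γ' t) :
    HasDerivAt (fun s => symmetry (γ s)) (2 * γ') t :=
  (h.const_mul 2).sub_const 1

theorem hasDerivAt_velocity_geodesicOf (p y : A) (t : ℝ) :
    HasDerivAt (fun s => (Complex.I / 2) • (y * symmetry (geodesicOf p y s)))
      ((-(1 / 2) : ℂ) • (y * y * symmetry (geodesicOf p y t))) t := by
  refine (((hasDerivAt_symmetry (hasDerivAt_geodesicOf p y t)).const_mul y).const_smul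
    (Complex.I / 2)).congr_deriv ?_
  rw [two_mul, ← add_smul, add_halves, mul_smul_comm, smul_smul, mul_assoc, div_mul_eq_mul_div,
    Complex.I_mul_I, neg_div]

namespace IsCodiagonal

variable {p y : A}

theorem isStarProjection_geodesicOf (hp : IsStarProjection p) (hy : IsCodiagonal p y) (t : ℝ) :
    IsStarProjection (geodesicOf p y t) :=
  isStarProjection_half_smul (isSelfAdjoint_exp_mul_symmetry hp.isSelfAdjoint (hy.real_smul t))
    (exp_mul_symmetry_mul_self hp.isIdempotentElem (hy.real_smul t))

theorem geodesicOf_right (hy : IsCodiagonal p y) (t : ℝ) : IsCodiagonal (geodesicOf p y t) y where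
  isSelfAdjoint := hy.isSelfAdjoint
  symmetry_mul := by
    have hcomm : y * NormedSpace.exp (Complex.I • t • y) =
        NormedSpace.exp (Complex.I • t • y) * y :=
      semiconjBy_exp (((Commute.refl y).smul_right t).smul_right Complex.I)
    rw [symmetry_geodesicOf, mul_assoc, hy.symmetry_mul, mul_neg, ← mul_assoc, ← mul_assoc, hcomm]

theorem commute_symmetry_mul_self (hy : IsCodiagonal p y) : Commute (symmetry p) (y * y) := by
  change _ = _
  rw [← mul_assoc, hy.symmetry_mul, neg_mul, mul_assoc, hy.symmetry_mul, mul_neg, neg_neg,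
    mul_assoc]

theorem commute_mul_self_mul_symmetry (hy : IsCodiagonal p y) :
    Commute p (y * y * symmetry p) := by
  nth_rewrite 1 [← half_smul_symmetry p]
  exact ((Commute.one_left _).add_left
    (hy.commute_symmetry_mul_self.mul_right (Commute.refl _))).smul_left _

theorem norm_deriv_geodesicOf (hp : IsStarProjection p) (hy : IsCodiagonal p y) (t : ℝ) :
    ‖deriv (geodesicOf p y) t‖ = ‖y‖ / 2 := by
  rw [(hasDerivAt_geodesicOf p y t).deriv, norm_smul, CStarRing.norm_mul_mem_unitary _
    (symmetry_mem_unitary (hy.isStarProjection_geodesicOf hp t)), norm_div, Complex.norm_I]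
  norm_num
  ring

theorem norm_geodesicOf_sub_le (hp : IsStarProjection p) (hy : IsCodiagonal p y) (s t : ℝ) :
    ‖geodesicOf p y s - geodesicOf p y t‖ ≤ ‖y‖ / 2 * |s - t| :=
  convex_univ.norm_image_sub_le_of_norm_deriv_le (𝕜 := ℝ)
    (fun x _ => (hasDerivAt_geodesicOf p y x).differentiableAt)
    (fun x _ => (hy.norm_deriv_geodesicOf hp x).le) (mem_univ t) (mem_univ s)

end IsCodiagonal

end Geodesic

section GeodesicOperator

variable {H : Type*} [NormedAddCommGroup H] [InnerProductSpace ℂ H]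

theorem tangentProj_eq_zero_of_commute {P X : H →L[ℂ] H} (hP : IsIdempotentElem P)
    (hPX : Commute P X) : tangentProj P X = 0 := by
  have hPXP : P * X * P = P * X := by rw [mul_assoc, ← hPX.eq, ← mul_assoc, hP.eq]
  rw [tangentProj, mul_sub, mul_one, hPXP, sub_self, sub_mul, sub_mul, one_mul, hPXP, ← hPX.eq,
    sub_self, add_zero]

theorem IsCodiagonal.isGeodesic_geodesicOf [CompleteSpace H] {P Y : H →L[ℂ] H}
    (hP : IsStarProjection P) (hY : IsCodiagonal P Y) : IsGeodesic (geodesicOf P Y) := by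
  refine ⟨(contDiff_geodesicOf P Y).contDiffOn, fun t _ => hY.isStarProjection_geodesicOf hP t,
    fun t ht => ?_⟩
  have hunique := uniqueDiffOn_Icc (zero_lt_one' ℝ)
  have hvelocity : EqOn (derivWithin (geodesicOf P Y) (Icc 0 1))
      (fun s => (Complex.I / 2) • (Y * symmetry (geodesicOf P Y s))) (Icc 0 1) := fun s hs =>
    (hasDerivAt_geodesicOf P Y s).hasDerivWithinAt.derivWithin (hunique s hs)
  rw [covDeriv, derivWithin_congr hvelocity (hvelocity ht),
    (hasDerivAt_velocity_geodesicOf P Y t).hasDerivWithinAt.derivWithin (hunique t ht)]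
  exact tangentProj_eq_zero_of_commute (hY.isStarProjection_geodesicOf hP t).isIdempotentElem
    ((hY.geodesicOf_right t).commute_mul_self_mul_symmetry.smul_right _)

end GeodesicOperator

/-! ### Generators of minimal length -/

/-- `y` generates a geodesic from `p` to `q` whose symmetries rotate by angles at most `π`. -/
structure IsGeodesicGenerator {A : Type*} [CStarAlgebra A] (p q y : A) : Prop
    extends IsCodiagonal p y where
  norm_le_pi : ‖y‖ ≤ Real.pi
  exp_mul_symmetry : NormedSpace.exp (Complex.I • y) * symmetry p = symmetry q

section Generator

variable {A : Type*} [CStarAlgebra A]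

theorem dslope_exp_zero_ne_zero {z : ℂ} (hz : ‖z‖ < 2 * Real.pi) :
    dslope Complex.exp 0 z ≠ 0 := by
  intro h
  have hexp := sub_smul_dslope Complex.exp 0 z
  rw [h, smul_zero, Complex.exp_zero, eq_comm, sub_eq_zero, Complex.exp_eq_one_iff] at hexp
  obtain ⟨n, rfl⟩ := hexp
  have hn : |(n : ℝ)| < 1 := by
    rw [norm_mul, Complex.norm_intCast] at hz
    have hnorm : ‖(2 * Real.pi * Complex.I : ℂ)‖ = 2 * Real.pi := by
      simp [abs_of_pos Real.pi_pos]
    rw [hnorm] at hz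
    nlinarith [Real.pi_pos]
  obtain rfl : n = 0 := by exact_mod_cast Int.abs_lt_one_iff.1 (by exact_mod_cast hn)
  simp at h

theorem continuous_dslope_exp : Continuous (dslope Complex.exp 0) :=
  continuousOn_univ.1 ((continuousOn_dslope Filter.univ_mem).2
    ⟨Complex.continuous_exp.continuousOn, Complex.differentiableAt_exp⟩)

theorem exp_sub_one_eq_cfc_mul (x : A) [IsStarNormal x] :
    NormedSpace.exp x - 1 = cfc (dslope Complex.exp 0) x * x := by
  have hcont := continuous_dslope_exp.continuousOn (s := spectrum ℂ x)
  calc NormedSpace.exp x - 1 = cfc (fun z => Complex.exp z - 1) x := by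
        rw [cfc_sub Complex.exp (fun _ => 1) x, cfc_const_one ℂ x, Complex.exp_eq_exp_ℂ,
          CFC.exp_eq_normedSpace_exp (𝕜 := ℂ)]
    _ = cfc (fun z => dslope Complex.exp 0 z * z) x := by
        refine cfc_congr fun z _ => ?_
        have hslope := sub_smul_dslope Complex.exp 0 z
        rwa [sub_zero, Complex.exp_zero, smul_eq_mul, mul_comm, eq_comm] at hslope
    _ = cfc (dslope Complex.exp 0) x * x := by rw [cfc_mul _ _ x, cfc_id' ℂ x]

theorem exists_eq_mul_exp_sub_one {x : A} [IsStarNormal x] (hx : ‖x‖ < 2 * Real.pi) :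
    ∃ h : A, x = h * (NormedSpace.exp x - 1) := by
  nontriviality A
  have hcont := continuous_dslope_exp.continuousOn (s := spectrum ℂ x)
  have hne : ∀ z ∈ spectrum ℂ x, dslope Complex.exp 0 z ≠ 0 := fun z hz =>
    dslope_exp_zero_ne_zero ((spectrum.norm_le_norm_of_mem hz).trans_lt hx)
  refine ⟨cfc (fun z => (dslope Complex.exp 0 z)⁻¹) x, ?_⟩
  have hone : cfc (fun z => (dslope Complex.exp 0 z)⁻¹ * dslope Complex.exp 0 z) x = 1 := by
    rw [← cfc_const_one ℂ x]
    exact cfc_congr fun z hz => inv_mul_cancel₀ (hne z hz)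
  rw [cfc_mul (fun z => (dslope Complex.exp 0 z)⁻¹) _ x (hcont.inv₀ hne)] at hone
  rw [exp_sub_one_eq_cfc_mul, ← mul_assoc, hone, one_mul]

theorem isStarNormal_I_smul {y : A} (hy : IsSelfAdjoint y) : IsStarNormal (Complex.I • y) := ⟨by
  change _ * _ = _ * _
  simp only [star_smul, hy.star_eq, smul_mul_smul_comm, mul_comm]⟩

theorem exists_eq_mul_exp_I_smul_sub_one {y : A} (hy : IsSelfAdjoint y)
    (hπ : ‖y‖ < 2 * Real.pi) : ∃ h : A, y = h * (NormedSpace.exp (Complex.I • y) - 1) := by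
  have := isStarNormal_I_smul hy
  obtain ⟨h, hh⟩ := exists_eq_mul_exp_sub_one (x := Complex.I • y)
    (by rwa [norm_smul, Complex.norm_I, one_mul])
  refine ⟨-(Complex.I • h), ?_⟩
  rw [neg_mul, smul_mul_assoc, ← hh, smul_smul, Complex.I_mul_I, neg_one_smul, neg_neg]

theorem eq_of_exp_I_smul_eq {x y : A} (hx : IsSelfAdjoint x) (hy : IsSelfAdjoint y)
    (hxπ : ‖x‖ < Real.pi) (hyπ : ‖y‖ < Real.pi)
    (h : NormedSpace.exp (Complex.I • x) = NormedSpace.exp (Complex.I • y)) : x = y := by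
  have hunitary : selfAdjoint.expUnitary ⟨x, hx⟩ = selfAdjoint.expUnitary ⟨y, hy⟩ :=
    Subtype.ext h
  have harg := congrArg Unitary.argSelfAdjoint hunitary
  rw [argSelfAdjoint_expUnitary hxπ, argSelfAdjoint_expUnitary hyπ] at harg
  exact congrArg Subtype.val harg

/-- Conjugation by `ε_p` inverts `ε_q ε_p`, hence changes the sign of its logarithm. -/
theorem isCodiagonal_of_exp_eq {p q y : A} (hp : IsStarProjection p) (hq : IsStarProjection q)
    (hy : IsSelfAdjoint y) (hπ : ‖y‖ < Real.pi)
    (h : NormedSpace.exp (Complex.I • y) = symmetry q * symmetry p) : IsCodiagonal p y := by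
  refine ⟨hy, ?_⟩
  have hs := isSelfAdjoint_symmetry hp.isSelfAdjoint
  have hss := symmetry_mul_symmetry_self hp.isIdempotentElem
  have hsemi : SemiconjBy (symmetry p) (Complex.I • -(symmetry p * y * symmetry p))
      (-(Complex.I • y)) := by
    change _ * _ = _ * _
    rw [mul_smul_comm, mul_neg, mul_assoc, ← mul_assoc, hss, one_mul, smul_neg, neg_mul,
      smul_mul_assoc]
  have hexp : NormedSpace.exp (Complex.I • -(symmetry p * y * symmetry p)) =
      NormedSpace.exp (Complex.I • y) := by
    have hconj := (semiconjBy_exp hsemi).eq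
    rw [← star_exp_I_smul hy, h, star_mul, hs.star_eq,
      (isSelfAdjoint_symmetry hq.isSelfAdjoint).star_eq] at hconj
    rw [h, ← one_mul (NormedSpace.exp _), ← hss, mul_assoc, hconj, mul_assoc, ← mul_assoc, hss,
      one_mul]
  have hyconj : -(symmetry p * y * symmetry p) = y := by
    refine eq_of_exp_I_smul_eq ?_ hy ?_ hπ hexp
    · rw [IsSelfAdjoint, star_neg, star_mul, star_mul, hs.star_eq, hy.star_eq, mul_assoc]
    · rwa [norm_neg, CStarRing.norm_mul_mem_unitary _ (symmetry_mem_unitary hp),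
        CStarRing.norm_mem_unitary_mul _ (symmetry_mem_unitary hp)]
  nth_rewrite 1 [← hyconj]
  rw [mul_neg, mul_assoc, ← mul_assoc, hss, one_mul]

theorem norm_symmetry_mul_symmetry_sub_one {p q : A} (hp : IsStarProjection p) :
    ‖symmetry q * symmetry p - 1‖ = 2 * ‖p - q‖ := by
  have hfactor : symmetry q * symmetry p - 1 = -((2 : ℂ) • (p - q)) * symmetry p := by
    rw [two_smul, ← symmetry_mul_symmetry_self hp.isIdempotentElem, ← sub_mul]
    congr 1
    rw [symmetry, symmetry]
    noncomm_ring
  rw [hfactor, CStarRing.norm_mul_mem_unitary _ (symmetry_mem_unitary hp), norm_neg, norm_smul,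
    Complex.norm_ofNat]

theorem exists_isGeodesicGenerator_of_norm_sub_lt_one {p q : A} (hp : IsStarProjection p)
    (hq : IsStarProjection q) (hpq : ‖p - q‖ < 1) : ∃ y, IsGeodesicGenerator p q y := by
  let u : unitary A :=
    ⟨symmetry q * symmetry p, mul_mem (symmetry_mem_unitary hq) (symmetry_mem_unitary hp)⟩
  have hu : ‖(u - 1 : A)‖ < 2 := by
    change ‖symmetry q * symmetry p - 1‖ < 2
    rw [norm_symmetry_mul_symmetry_sub_one hp]
    linarith
  have hexp : NormedSpace.exp (Complex.I • (Unitary.argSelfAdjoint u : A)) =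
      symmetry q * symmetry p := congrArg Subtype.val (expUnitary_argSelfAdjoint hu)
  have hπ : ‖Unitary.argSelfAdjoint u‖ < Real.pi := by
    rw [Unitary.norm_argSelfAdjoint hu, Real.arccos_lt_pi]
    nlinarith [norm_nonneg (u - 1 : A)]
  refine ⟨Unitary.argSelfAdjoint u,
    isCodiagonal_of_exp_eq hp hq (Unitary.argSelfAdjoint u).2 hπ hexp, hπ.le, ?_⟩
  rw [hexp, mul_assoc, symmetry_mul_symmetry_self hp.isIdempotentElem, mul_one]

theorem exp_smul_of_isIdempotentElem {p : A} (hp : IsIdempotentElem p) (c : ℂ) :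
    NormedSpace.exp (c • p) = 1 - p + Complex.exp c • p := by
  have hrange : SemiconjBy p (c • 1) (c • p) := by
    change _ * _ = _ * _
    rw [mul_smul_comm, mul_one, smul_mul_assoc, hp.eq]
  have hker : SemiconjBy (1 - p) 0 (c • p) := by
    change _ * _ = _ * _
    rw [mul_zero, smul_mul_assoc, hp.mul_one_sub_self, smul_zero]
  have hrange_exp := (semiconjBy_exp hrange).eq
  have hker_exp := (semiconjBy_exp hker).eq
  rw [← Algebra.algebraMap_eq_smul_one, ← NormedSpace.algebraMap_exp_comm,
    ← Complex.exp_eq_exp_ℂ, Algebra.algebraMap_eq_smul_one, mul_smul_comm, mul_one] at hrange_exp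
  rw [NormedSpace.exp_zero, mul_one, mul_sub, mul_one, ← hrange_exp] at hker_exp
  rw [hker_exp, sub_add_cancel]

theorem mul_eq_self_of_mul_self {j d : A} (hj : IsSelfAdjoint j) (hd : IsStarProjection d)
    (hjd : j * j = d) : j * d = j := by
  rw [← sub_eq_zero, ← CStarRing.star_mul_self_eq_zero_iff, star_sub, star_mul, hj.star_eq,
    hd.isSelfAdjoint.star_eq]
  calc (d * j - j) * (j * d - j)
      = d * (j * j) * d - d * (j * j) - j * j * d + j * j := by noncomm_ring
    _ = 0 := by rw [hjd, hd.isIdempotentElem.eq, hd.isIdempotentElem.eq, sub_self,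
        zero_sub, neg_add_cancel]

/-- `j = 2e - d` for the idempotent `e = (d + j) / 2`, and `e^{2πie} = 1`, `e^{-iπd} = 1 - 2d`. -/
theorem exp_I_smul_pi_smul {j d : A} (hj : IsSelfAdjoint j) (hd : IsStarProjection d)
    (hjd : j * j = d) : NormedSpace.exp (Complex.I • Real.pi • j) = -symmetry d := by
  let +nondep : NormedAlgebra ℚ A := .restrictScalars ℚ ℂ A
  have hjd' : j * d = j := mul_eq_self_of_mul_self hj hd hjd
  have hdj : d * j = j := by rw [← hjd, mul_assoc, hjd, hjd']
  have he : IsIdempotentElem ((1 / 2 : ℂ) • (d + j)) := by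
    change _ * _ = _
    simp only [smul_mul_smul_comm, mul_add, add_mul, hd.isIdempotentElem.eq, hjd, hjd', hdj]
    module
  have hcomm : Commute ((1 / 2 : ℂ) • (d + j)) d := by
    refine Commute.smul_left (Commute.add_left (Commute.refl d) ?_) _
    exact hjd'.trans hdj.symm
  have hsplit : Complex.I • Real.pi • j =
      (2 * Real.pi * Complex.I) • ((1 / 2 : ℂ) • (d + j)) + (-(Real.pi * Complex.I)) • d := by
    rw [← Complex.coe_smul]
    module
  rw [hsplit, NormedSpace.exp_add_of_commute ((hcomm.smul_left _).smul_right _),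
    exp_smul_of_isIdempotentElem he, exp_smul_of_isIdempotentElem hd.isIdempotentElem,
    Complex.exp_two_pi_mul_I, Complex.exp_neg, Complex.exp_pi_mul_I, one_smul,
    sub_add_cancel, one_mul, inv_neg_one, neg_one_smul, symmetry]
  noncomm_ring

/-- The projection that agrees with `q` on the kernel of `d` and with `1 - q` on its range, for a
projection `d` commuting with `q`. -/
def flipOn (d q : A) : A := q - symmetry q * d

theorem symmetry_flipOn (d q : A) : symmetry (flipOn d q) = -(symmetry q * symmetry d) := by
  rw [flipOn, symmetry, symmetry, symmetry]
  noncomm_ring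

theorem isStarProjection_flipOn {d q : A} (hd : IsStarProjection d) (hq : IsStarProjection q)
    (hdq : Commute (symmetry q) d) : IsStarProjection (flipOn d q) := by
  have hcomm := (commute_symmetry_right hdq).eq
  rw [← half_smul_symmetry (flipOn d q), symmetry_flipOn]
  refine isStarProjection_half_smul ?_ ?_
  · rw [IsSelfAdjoint, star_neg, star_mul, (isSelfAdjoint_symmetry hd.isSelfAdjoint).star_eq,
      (isSelfAdjoint_symmetry hq.isSelfAdjoint).star_eq, hcomm]
  · rw [neg_mul_neg, mul_assoc, ← mul_assoc (symmetry d), ← hcomm, mul_assoc,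
      symmetry_mul_symmetry_self hd.isIdempotentElem, mul_one,
      symmetry_mul_symmetry_self hq.isIdempotentElem]

/-- Only the range of `d` is left to be moved, and there `j` generates half turns. -/
theorem IsGeodesicGenerator.add_pi_smul {p q d y j : A} (hy : IsGeodesicGenerator p (flipOn d q) y)
    (hj : IsCodiagonal p j) (hd : IsStarProjection d) (hjd : j * j = d) (hyd : y * d = 0) :
    IsGeodesicGenerator p q (y + Real.pi • j) := by
  have hdj : d * j = j := by
    rw [← hjd, mul_assoc, hjd, mul_eq_self_of_mul_self hj.isSelfAdjoint hd hjd]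
  have hyj : y * j = 0 := by rw [← hdj, ← mul_assoc, hyd, zero_mul]
  have hjy : j * y = 0 := by
    rw [← star_eq_zero, star_mul, hy.isSelfAdjoint.star_eq, hj.isSelfAdjoint.star_eq, hyj]
  have hj1 : ‖j‖ ≤ 1 := by
    have hd1 := IsStarProjection.norm_le d hd
    have hsq := CStarRing.norm_star_mul_self (x := j)
    rw [hj.isSelfAdjoint.star_eq, hjd] at hsq
    nlinarith [norm_nonneg j]
  have hpd : Commute (symmetry p) d := hjd ▸ hj.commute_symmetry_mul_self
  refine ⟨⟨?_, ?_⟩, ?_, ?_⟩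
  · exact hy.isSelfAdjoint.add (hj.real_smul Real.pi).isSelfAdjoint
  · rw [mul_add, add_mul, hy.symmetry_mul, (hj.real_smul Real.pi).symmetry_mul, neg_add]
  · rw [hy.isSelfAdjoint.norm_add_eq_max (hj.real_smul Real.pi).isSelfAdjoint
      (by rw [mul_smul_comm, hyj, smul_zero]), norm_smul, Real.norm_of_nonneg Real.pi_nonneg]
    exact max_le hy.norm_le_pi (mul_le_of_le_one_right Real.pi_nonneg hj1)
  · let +nondep : NormedAlgebra ℚ A := .restrictScalars ℚ ℂ A
    have hcomm : Commute (Complex.I • y) (Complex.I • Real.pi • j) :=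
      (((show Commute y j from hyj.trans hjy.symm).smul_right _).smul_right _).smul_left _
    have hpd' : symmetry d * symmetry p = symmetry p * symmetry d :=
      (commute_symmetry_right hpd).eq.symm
    rw [smul_add, NormedSpace.exp_add_of_commute hcomm, exp_I_smul_pi_smul hj.isSelfAdjoint hd hjd,
      mul_neg, neg_mul, mul_assoc, hpd', ← mul_assoc, hy.exp_mul_symmetry,
      symmetry_flipOn, neg_mul, neg_neg, mul_assoc, symmetry_mul_symmetry_self hd.isIdempotentElem,
      mul_one]

theorem IsGeodesicGenerator.mul_eq_zero {p q d y : A} (hp : IsIdempotentElem p)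
    (hd : IsIdempotentElem d) (hpd : Commute (symmetry p) d)
    (hqd : symmetry q * d = -(symmetry p * d)) (hy : IsGeodesicGenerator p (flipOn d q) y) :
    y * d = 0 := by
  have hsd : symmetry d * d = d := by
    rw [symmetry, sub_mul, mul_assoc, hd.eq, one_mul, two_mul, add_sub_cancel_right]
  have hexp : NormedSpace.exp (Complex.I • y) * d = d :=
    calc NormedSpace.exp (Complex.I • y) * d
        = NormedSpace.exp (Complex.I • y) * symmetry p * (symmetry p * d) := by
          rw [mul_assoc, ← mul_assoc (symmetry p), symmetry_mul_symmetry_self hp, one_mul]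
      _ = -(symmetry q * (symmetry d * d) * symmetry p) := by
          rw [hy.exp_mul_symmetry, symmetry_flipOn, hpd.eq, neg_mul, mul_assoc, mul_assoc,
            mul_assoc]
      _ = d := by
          rw [hsd, hqd, neg_mul, neg_neg, hpd.eq, mul_assoc, symmetry_mul_symmetry_self hp,
            mul_one]
  obtain ⟨h, hh⟩ := exists_eq_mul_exp_I_smul_sub_one hy.isSelfAdjoint
    (hy.norm_le_pi.trans_lt (by linarith [Real.pi_pos]))
  rw [hh, mul_assoc, sub_mul, hexp, one_mul, sub_self, mul_zero]

theorem commute_symmetry_of_symmetry_mul_eq_neg {p q d : A} (hp : IsSelfAdjoint p)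
    (hq : IsSelfAdjoint q) (hd : IsSelfAdjoint d) (hpd : Commute (symmetry p) d)
    (hqd : symmetry q * d = -(symmetry p * d)) : Commute (symmetry q) d := by
  have hstar := congrArg star hqd
  rw [star_neg, star_mul, star_mul, hd.star_eq, (isSelfAdjoint_symmetry hq).star_eq,
    (isSelfAdjoint_symmetry hp).star_eq, ← hpd.eq, ← hqd] at hstar
  exact hstar.symm

theorem exists_isGeodesicGenerator_of_norm_sub_flipOn_lt_one {p q d j : A}
    (hp : IsStarProjection p) (hq : IsStarProjection q) (hd : IsStarProjection d)
    (hqd : symmetry q * d = -(symmetry p * d)) (hj : IsCodiagonal p j) (hjd : j * j = d)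
    (hlt : ‖p - flipOn d q‖ < 1) : ∃ y, IsGeodesicGenerator p q y := by
  have hpd : Commute (symmetry p) d := hjd ▸ hj.commute_symmetry_mul_self
  have hqd' := commute_symmetry_of_symmetry_mul_eq_neg hp.isSelfAdjoint hq.isSelfAdjoint
    hd.isSelfAdjoint hpd hqd
  obtain ⟨y, hy⟩ := exists_isGeodesicGenerator_of_norm_sub_lt_one hp
    (isStarProjection_flipOn hd hq hqd') hlt
  exact ⟨_, hy.add_pi_smul hj hd hjd
    (hy.mul_eq_zero hp.isIdempotentElem hd.isIdempotentElem hpd hqd)⟩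

end Generator

/-! ### Generators between compact perturbations -/

theorem sub_mul_self_add_add_sub_one_mul_self {A : Type*} [Ring A] {p q : A}
    (hp : IsIdempotentElem p) (hq : IsIdempotentElem q) :
    (p - q) * (p - q) + (p + q - 1) * (p + q - 1) = 1 := by
  calc _ = 2 * (p * p - p) + 2 * (q * q - q) + 1 := by noncomm_ring
    _ = 1 := by rw [hp.eq, hq.eq, sub_self, sub_self, mul_zero, zero_add, zero_add]

section CompactGenerator

variable {H : Type*} [NormedAddCommGroup H] [InnerProductSpace ℂ H]

theorem isCompactOperator_starProjection (M : Submodule ℂ H) [FiniteDimensional ℂ M] :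
    IsCompactOperator M.starProjection :=
  (isCompactOperator_of_locallyCompactSpace_rng M.subtypeL).comp_clm M.orthogonalProjectionOnto

theorem mul_starProjection_eq_self {P : H →L[ℂ] H} (hP : IsIdempotentElem P) {M : Submodule ℂ H}
    [M.HasOrthogonalProjection] (hM : M ≤ P.range) : P * M.starProjection = M.starProjection :=
  ContinuousLinearMap.ext fun x =>
    apply_eq_self_of_mem_range hP (hM (Submodule.starProjection_apply_mem M x))

theorem mul_starProjection_eq_zero {P : H →L[ℂ] H} {M : Submodule ℂ H}
    [M.HasOrthogonalProjection] (hM : M ≤ P.ker) : P * M.starProjection = 0 :=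
  ContinuousLinearMap.ext fun x => hM (Submodule.starProjection_apply_mem M x)

theorem symmetry_mul_starProjection_add {P : H →L[ℂ] H} (hP : IsIdempotentElem P)
    {M N : Submodule ℂ H} [M.HasOrthogonalProjection] [N.HasOrthogonalProjection]
    (hM : M ≤ P.range) (hN : N ≤ P.ker) :
    symmetry P * (M.starProjection + N.starProjection) = M.starProjection - N.starProjection := by
  rw [symmetry, sub_mul, mul_assoc, mul_add, mul_starProjection_eq_self hP hM,
    mul_starProjection_eq_zero hN, add_zero, one_mul, two_mul]
  abel

variable [CompleteSpace H]

theorem exists_unit_eigenvector_norm {Y : H →L[ℂ] H} (hY : IsSelfAdjoint Y)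
    (hcompact : IsCompactOperator Y) (hne : Y ≠ 0) :
    ∃ (v : H) (r : ℝ), ‖v‖ = 1 ∧ |r| = ‖Y‖ ∧ Y v = (r : ℂ) • v := by
  have : Nontrivial (H →L[ℂ] H) := ⟨Y, 0, hne⟩
  obtain ⟨r, hr, hmem⟩ : ∃ r : ℝ, |r| = ‖Y‖ ∧ r ∈ spectrum ℝ Y := by
    rcases CStarAlgebra.norm_or_neg_norm_mem_spectrum hY with h | h
    · exact ⟨_, abs_norm Y, h⟩
    · exact ⟨_, by rw [abs_neg, abs_norm], h⟩
  have hr0 : (r : ℂ) ≠ 0 := Complex.ofReal_ne_zero.2 <| abs_ne_zero.1 (hr ▸ norm_ne_zero_iff.2 hne)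
  have hmem' : (r : ℂ) ∈ spectrum ℂ Y := by
    rw [← hY.spectrumRestricts.algebraMap_image]
    exact ⟨r, hmem, rfl⟩
  obtain ⟨v, hv⟩ := ((hcompact.hasEigenvalue_iff_mem_spectrum hr0).2 hmem').exists_hasEigenvector
  refine ⟨(‖v‖⁻¹ : ℂ) • v, r, norm_smul_inv_norm hv.2, hr, ?_⟩
  rw [map_smul, smul_comm]
  exact congrArg _ hv.apply_eq_smul

theorem norm_sub_lt_one_of_ker_eq_bot {P Q : H →L[ℂ] H} (hP : IsStarProjection P)
    (hQ : IsStarProjection Q) (hPQ : IsCompactOperator (P - Q)) (hker : (P + Q - 1).ker = ⊥) :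
    ‖P - Q‖ < 1 := by
  rcases eq_or_ne (P - Q) 0 with h0 | h0
  · rw [h0, norm_zero]
    exact zero_lt_one
  obtain ⟨v, r, hv, hr, heig⟩ :=
    exists_unit_eigenvector_norm (hP.isSelfAdjoint.sub hQ.isSelfAdjoint) hPQ h0
  have hsa : IsSelfAdjoint (P + Q - 1) := (hP.isSelfAdjoint.add hQ.isSelfAdjoint).sub (.one _)
  have hsq : (P + Q - 1) ((P + Q - 1) v) = ((1 - r ^ 2 : ℝ) : ℂ) • v := by
    have hid := congrArg (fun T : H →L[ℂ] H => T v)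
      (sub_mul_self_add_add_sub_one_mul_self hP.isIdempotentElem hQ.isIdempotentElem)
    change (P - Q) ((P - Q) v) + (P + Q - 1) ((P + Q - 1) v) = v at hid
    rw [heig, map_smul, heig, smul_smul] at hid
    rw [eq_sub_of_add_eq' hid]
    push_cast
    module
  have hnorm : ‖(P + Q - 1) v‖ ^ 2 = 1 - r ^ 2 := by
    have hinner : inner ℂ ((P + Q - 1) v) ((P + Q - 1) v) =
        inner ℂ v ((P + Q - 1) ((P + Q - 1) v)) := hsa.isSymmetric v _
    rw [hsq, inner_smul_right, inner_self_eq_norm_sq_to_K, inner_self_eq_norm_sq_to_K, hv] at hinner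
    apply Complex.ofReal_injective
    simpa using hinner
  have hpos : 0 < ‖(P + Q - 1) v‖ := norm_pos_iff.2 fun h => by
    have hv0 : v = 0 := by rwa [← Submodule.mem_bot ℂ, ← hker]
    exact one_ne_zero (hv.symm.trans (hv0 ▸ norm_zero))
  rw [← hr, ← sq_lt_one_iff_abs_lt_one]
  nlinarith

theorem exists_partialIsometry {M N : Submodule ℂ H} [FiniteDimensional ℂ M]
    [FiniteDimensional ℂ N] (h : Module.finrank ℂ M = Module.finrank ℂ N) :
    ∃ W : H →L[ℂ] H, star W * W = M.starProjection ∧ W * star W = N.starProjection ∧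
      W * M.starProjection = W ∧ N.starProjection * W = W := by
  let L : M ≃ₗᵢ[ℂ] N := (stdOrthonormalBasis ℂ M).equiv (stdOrthonormalBasis ℂ N) (finCongr h)
  let W : H →L[ℂ] H := N.subtypeL ∘L (L : M →L[ℂ] N) ∘L M.orthogonalProjectionOnto
  let V : H →L[ℂ] H := M.subtypeL ∘L (L.symm : N →L[ℂ] M) ∘L N.orthogonalProjectionOnto
  have hW (x : H) : W x = L (M.orthogonalProjectionOnto x) := rfl
  have hV (x : H) : V x = L.symm (N.orthogonalProjectionOnto x) := rfl
  have hstar : star W = V := by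
    refine ((ContinuousLinearMap.eq_adjoint_iff _ _).2 fun x y => ?_).symm
    rw [hW, hV, ← Submodule.inner_orthogonalProjectionOnto_eq_of_mem_left,
      ← Submodule.inner_orthogonalProjectionOnto_eq_of_mem_right, ← L.inner_map_map,
      L.apply_symm_apply]
  refine ⟨W, ?_, ?_, ?_, ?_⟩
  · ext x
    change star W (W x) = M.orthogonalProjectionOnto x
    rw [hstar, hV, hW, Submodule.orthogonalProjectionOnto_mem_subspace_eq_self, L.symm_apply_apply]
  · ext x
    change W (star W x) = N.orthogonalProjectionOnto x
    rw [hstar, hW, hV, Submodule.orthogonalProjectionOnto_mem_subspace_eq_self, L.apply_symm_apply]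
  · ext x
    change W (M.orthogonalProjectionOnto x) = W x
    rw [hW, hW, Submodule.orthogonalProjectionOnto_mem_subspace_eq_self]
  · ext x
    exact Submodule.starProjection_eq_self_iff.2 (SetLike.coe_mem _)

theorem exists_exchange {M N : Submodule ℂ H} [FiniteDimensional ℂ M] [FiniteDimensional ℂ N]
    (hMN : M ⟂ N) (hfinrank : Module.finrank ℂ M = Module.finrank ℂ N) :
    ∃ J : H →L[ℂ] H, IsSelfAdjoint J ∧ J * J = M.starProjection + N.starProjection ∧
      J * M.starProjection = N.starProjection * J := by
  obtain ⟨W, hWW, hWW', hWM, hNW⟩ := exists_partialIsometry hfinrank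
  have hmul : M.starProjection * N.starProjection = 0 := hMN.starProjection_comp_starProjection
  have hsq : W * W = 0 := by
    calc W * W = W * M.starProjection * (N.starProjection * W) := by rw [hWM, hNW]
      _ = W * (M.starProjection * N.starProjection) * W := by simp only [mul_assoc]
      _ = 0 := by rw [hmul, mul_zero, zero_mul]
  have hsq' : star W * star W = 0 := by rw [← star_mul, hsq, star_zero]
  refine ⟨W + star W, .add_star_self W, ?_, ?_⟩
  · rw [add_mul, mul_add, mul_add, hsq, hsq', hWW, hWW', zero_add, add_zero, add_comm]
  · rw [← hWW, ← hWW', add_mul, mul_add, ← mul_assoc, ← mul_assoc (star W), hsq', zero_mul,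
      add_zero, mul_assoc W (star W) (star W), hsq', mul_zero, add_zero, mul_assoc]

theorem exists_isCodiagonal_mul_self_eq_starProjection_add {P : H →L[ℂ] H}
    (hP : IsStarProjection P) {M N : Submodule ℂ H} [FiniteDimensional ℂ M]
    [FiniteDimensional ℂ N] (hM : M ≤ P.range) (hN : N ≤ P.ker) (hMN : M ⟂ N)
    (hfinrank : Module.finrank ℂ M = Module.finrank ℂ N) :
    ∃ J : H →L[ℂ] H, IsCodiagonal P J ∧ J * J = M.starProjection + N.starProjection := by
  obtain ⟨J, hJ, hJJ, hexch⟩ := exists_exchange hMN hfinrank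
  have hd : IsStarProjection (M.starProjection + N.starProjection) :=
    isStarProjection_starProjection.add isStarProjection_starProjection
      hMN.starProjection_comp_starProjection
  have hsymm : symmetry P * (J * J) = M.starProjection - N.starProjection := by
    rw [hJJ, symmetry_mul_starProjection_add hP.isIdempotentElem hM hN]
  have hcomm : (M.starProjection - N.starProjection) * J
      = -(J * (M.starProjection - N.starProjection)) := by
    have hexch' := congrArg star hexch
    rw [star_mul, star_mul, hJ.star_eq, isStarProjection_starProjection.isSelfAdjoint.star_eq,
      isStarProjection_starProjection.isSelfAdjoint.star_eq] at hexch'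
    rw [sub_mul, mul_sub, hexch, hexch', neg_sub]
  have hsymm' : J * J * symmetry P = M.starProjection - N.starProjection := by
    have hstar := congrArg star hsymm
    rwa [star_mul, star_mul, hJ.star_eq, (isSelfAdjoint_symmetry hP.isSelfAdjoint).star_eq,
      (isStarProjection_starProjection.isSelfAdjoint.sub
        isStarProjection_starProjection.isSelfAdjoint).star_eq] at hstar
  have hcube : J * J * J = J := by
    rw [mul_assoc]
    exact mul_eq_self_of_mul_self hJ (hJJ ▸ hd) rfl
  refine ⟨J, ⟨hJ, ?_⟩, hJJ⟩
  calc symmetry P * J = symmetry P * (J * J) * J := by rw [mul_assoc, hcube]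
    _ = -(J * (J * J * symmetry P)) := by rw [hsymm, hcomm, hsymm']
    _ = -(J * symmetry P) := by rw [← mul_assoc, ← mul_assoc, hcube]

theorem isOrtho_range_inf_ker {P : H →L[ℂ] H} (hP : IsStarProjection P) (S T : Submodule ℂ H) :
    (P.range ⊓ S) ⟂ (T ⊓ P.ker) := by
  refine Submodule.isOrtho_iff_inner_eq.2 fun x hx y hy => ?_
  rw [← apply_eq_self_of_mem_range hP.isIdempotentElem hx.1]
  have hPy : P y = 0 := hy.2
  calc inner ℂ (P x) y = inner ℂ x (P y) := hP.isSelfAdjoint.isSymmetric x y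
    _ = 0 := by rw [hPy, inner_zero_right]

theorem starProjection_add_mul_add_sub_one {P Q : H →L[ℂ] H} (hP : IsStarProjection P)
    (hQ : IsStarProjection Q) {M N : Submodule ℂ H} [M.HasOrthogonalProjection]
    [N.HasOrthogonalProjection] (hM : M ≤ P.range ⊓ Q.ker) (hN : N ≤ Q.range ⊓ P.ker) :
    (M.starProjection + N.starProjection) * (P + Q - 1) = 0 := by
  obtain ⟨hMP, hMQ⟩ := le_inf_iff.1 hM
  obtain ⟨hNQ, hNP⟩ := le_inf_iff.1 hN
  have hzero : (P + Q - 1) * (M.starProjection + N.starProjection) = 0 := by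
    rw [sub_mul, add_mul, mul_add, mul_add, mul_starProjection_eq_self hP.isIdempotentElem hMP,
      mul_starProjection_eq_self hQ.isIdempotentElem hNQ, mul_starProjection_eq_zero hMQ,
      mul_starProjection_eq_zero hNP, add_zero, zero_add, one_mul, sub_self]
  have hstar := congrArg star hzero
  rwa [star_mul, star_add, isStarProjection_starProjection.isSelfAdjoint.star_eq,
    isStarProjection_starProjection.isSelfAdjoint.star_eq, star_zero,
    ((hP.isSelfAdjoint.add hQ.isSelfAdjoint).sub (.one _)).star_eq] at hstar

theorem starProjection_add_apply_of_mem_ker {P Q : H →L[ℂ] H} (hP : IsStarProjection P)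
    (hQ : IsStarProjection Q) {M N : Submodule ℂ H} [M.HasOrthogonalProjection]
    [N.HasOrthogonalProjection] (hM : M = P.range ⊓ Q.ker) (hN : N = Q.range ⊓ P.ker)
    {x : H} (hx : x ∈ (P + Q - 1).ker) : (M.starProjection + N.starProjection) x = x := by
  have hsum : P x + Q x = x := sub_eq_zero.1 hx
  have hPP : P (P x) = P x := apply_eq_self_of_mem_range hP.isIdempotentElem ⟨x, rfl⟩
  have hQQ : Q (Q x) = Q x := apply_eq_self_of_mem_range hQ.isIdempotentElem ⟨x, rfl⟩
  have hPM : P x ∈ M := by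
    refine hM ▸ ⟨⟨x, rfl⟩, ?_⟩
    have h := congrArg Q hsum
    rwa [map_add, hQQ, add_eq_right] at h
  have hQN : Q x ∈ N := by
    refine hN ▸ ⟨⟨x, rfl⟩, ?_⟩
    have h := congrArg P hsum
    rwa [map_add, hPP, add_eq_left] at h
  have hMN : M ⟂ N := hM ▸ hN ▸ isOrtho_range_inf_ker hP _ _
  change M.starProjection x + N.starProjection x = x
  nth_rw 1 2 [← hsum]
  rw [map_add, map_add, Submodule.starProjection_eq_self_iff.2 hPM,
    Submodule.starProjection_eq_self_iff.2 hQN,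
    (Submodule.starProjection_apply_eq_zero_iff M).2 (hMN.symm hQN),
    (Submodule.starProjection_apply_eq_zero_iff N).2 (hMN hPM), add_zero, zero_add, hsum]

theorem ker_add_flipOn_sub_one {P Q d : H →L[ℂ] H} (hQ : IsIdempotentElem Q)
    (hd : IsIdempotentElem d) (hcomm : Commute (symmetry Q) d) (hmul : d * (P + Q - 1) = 0)
    (hker : ∀ x ∈ (P + Q - 1).ker, d x = x) : (P + flipOn d Q - 1).ker = ⊥ := by
  refine (Submodule.eq_bot_iff _).2 fun x hx => ?_
  have hx' : (P + Q - 1) x = (symmetry Q * d) x := by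
    have hsplit : P + Q - 1 = P + flipOn d Q - 1 + symmetry Q * d := by
      rw [flipOn]
      abel
    rw [hsplit]
    exact add_eq_right.2 hx
  have hzero : (symmetry Q * d) x = 0 :=
    calc (symmetry Q * d) x = (d * (symmetry Q * d)) x := by
          rw [← mul_assoc, ← hcomm.eq, mul_assoc, hd.eq]
      _ = (d * (P + Q - 1)) x := congrArg d hx'.symm
      _ = 0 := by rw [hmul]; rfl
  have hdx : d x = 0 :=
    calc d x = (symmetry Q * symmetry Q) (d x) := by rw [symmetry_mul_symmetry_self hQ]; rfl
      _ = symmetry Q ((symmetry Q * d) x) := rfl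
      _ = 0 := by rw [hzero, map_zero]
  rw [← hker x (hx'.trans hzero), hdx]

theorem exists_isGeodesicGenerator {P Q : H →L[ℂ] H} (hP : IsStarProjection P)
    (hQ : IsStarProjection Q) (hPQ : IsCompactOperator (P - Q)) (hindex : pairIndex P Q = 0) :
    ∃ Y, IsGeodesicGenerator P Q Y := by
  obtain ⟨M, hM⟩ : ∃ M, M = P.range ⊓ Q.ker := ⟨_, rfl⟩
  obtain ⟨N, hN⟩ : ∃ N, N = Q.range ⊓ P.ker := ⟨_, rfl⟩
  have hPi := hP.isIdempotentElem
  have hQi := hQ.isIdempotentElem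
  have : FiniteDimensional ℂ M := hM ▸ finiteDimensional_range_inf_ker hPi hQi hPQ
  have : FiniteDimensional ℂ N :=
    hN ▸ finiteDimensional_range_inf_ker hQi hPi (isCompactOperator_sub_comm hPQ)
  have hMN : M ⟂ N := hM ▸ hN ▸ isOrtho_range_inf_ker hP _ _
  have hfinrank : Module.finrank ℂ M = Module.finrank ℂ N := by
    rw [pairIndex_eq_finrank_sub hP hQ hPQ, ← hM, ← hN] at hindex
    exact_mod_cast sub_eq_zero.1 hindex
  obtain ⟨hMP, hMQ⟩ := le_inf_iff.1 hM.le
  obtain ⟨hNQ, hNP⟩ := le_inf_iff.1 hN.le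
  obtain ⟨J, hJ, hJJ⟩ :=
    exists_isCodiagonal_mul_self_eq_starProjection_add hP hMP hNP hMN hfinrank
  have hd : IsStarProjection (M.starProjection + N.starProjection) :=
    isStarProjection_starProjection.add isStarProjection_starProjection
      hMN.starProjection_comp_starProjection
  have hQd : symmetry Q * (M.starProjection + N.starProjection) =
      -(symmetry P * (M.starProjection + N.starProjection)) := by
    rw [symmetry_mul_starProjection_add hPi hMP hNP, neg_sub, add_comm,
      symmetry_mul_starProjection_add hQi hNQ hMQ]
  have hcomm := commute_symmetry_of_symmetry_mul_eq_neg hP.isSelfAdjoint hQ.isSelfAdjoint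
    hd.isSelfAdjoint (hJJ ▸ hJ.commute_symmetry_mul_self) hQd
  have hmul := starProjection_add_mul_add_sub_one hP hQ hM.le hN.le
  refine exists_isGeodesicGenerator_of_norm_sub_flipOn_lt_one hP hQ hd hQd hJ hJJ
    (norm_sub_lt_one_of_ker_eq_bot hP (isStarProjection_flipOn hd hQ hcomm) ?_
      (ker_add_flipOn_sub_one hQi hd.isIdempotentElem hcomm hmul fun x hx =>
        starProjection_add_apply_of_mem_ker hP hQ hM hN hx))
  rw [flipOn, ← sub_add]
  exact hPQ.add (((isCompactOperator_starProjection M).add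
    (isCompactOperator_starProjection N)).clm_comp (symmetry Q))

theorem isCompactOperator_exp_sub_one {X : H →L[ℂ] H} [IsStarNormal X]
    (hX : IsCompactOperator X) : IsCompactOperator (NormedSpace.exp X - 1 : H →L[ℂ] H) := by
  rw [exp_sub_one_eq_cfc_mul]
  exact hX.clm_comp (cfc (dslope Complex.exp 0) X)

theorem IsGeodesicGenerator.isCompactOperator {P Q Y : H →L[ℂ] H} (hP : IsStarProjection P)
    (hPQ : IsCompactOperator (P - Q)) (hY : IsGeodesicGenerator P Q Y) : IsCompactOperator Y := by
  obtain ⟨T, hT⟩ := exists_eq_mul_exp_I_smul_sub_one hY.isSelfAdjoint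
    (hY.norm_le_pi.trans_lt (by linarith [Real.pi_pos]))
  have hexp : NormedSpace.exp (Complex.I • Y) - 1 = 2 * (Q - P) * symmetry P := by
    calc NormedSpace.exp (Complex.I • Y) - 1
        = (NormedSpace.exp (Complex.I • Y) * symmetry P - symmetry P) * symmetry P := by
          rw [sub_mul, mul_assoc, symmetry_mul_symmetry_self hP.isIdempotentElem, mul_one]
      _ = 2 * (Q - P) * symmetry P := by
          rw [hY.exp_mul_symmetry, mul_sub, symmetry, symmetry, sub_sub_sub_cancel_right]
  rw [hT, hexp]
  exact (((isCompactOperator_sub_comm hPQ).clm_comp (2 : H →L[ℂ] H)).comp_clm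
    (symmetry P)).clm_comp T

theorem isCompactOperator_geodesicOf_sub {P Y : H →L[ℂ] H} (hYsa : IsSelfAdjoint Y)
    (hY : IsCompactOperator Y) (t : ℝ) : IsCompactOperator (geodesicOf P Y t - P) := by
  have := isStarNormal_I_smul ((IsSelfAdjoint.all t).smul hYsa)
  have hsub : geodesicOf P Y t - P =
      (1 / 2 : ℂ) • ((NormedSpace.exp (Complex.I • t • Y) - 1) * symmetry P) := by
    nth_rw 2 [← half_smul_symmetry P]
    rw [geodesicOf, ← smul_sub, add_sub_add_left_eq_sub, sub_mul, one_mul]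
  rw [hsub]
  have hexp : IsCompactOperator (NormedSpace.exp (Complex.I • t • Y) - 1 : H →L[ℂ] H) :=
    isCompactOperator_exp_sub_one ((hY.smul t).smul Complex.I)
  exact (hexp.comp_clm (symmetry P)).smul (1 / 2 : ℂ)

theorem haveCommonComplement_geodesicOf {P Y : H →L[ℂ] H} (hP : IsStarProjection P)
    (hY : IsCodiagonal P Y) (hπ : ‖Y‖ ≤ Real.pi) {t : ℝ} (ht : t ∈ Icc (0 : ℝ) 1) :
    HaveCommonComplement P.range (geodesicOf P Y t).range := by
  have hproj (s : ℝ) := hY.isStarProjection_geodesicOf hP s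
  have hhalf {s : ℝ} (hs : |s - t / 2| ≤ 1 / 2) :
      ‖geodesicOf P Y s - geodesicOf P Y (t / 2)‖ < 1 :=
    calc ‖geodesicOf P Y s - geodesicOf P Y (t / 2)‖ ≤ ‖Y‖ / 2 * |s - t / 2| :=
          hY.norm_geodesicOf_sub_le hP s (t / 2)
      _ ≤ Real.pi / 2 * (1 / 2) := by gcongr
      _ < 1 := by linarith [Real.pi_lt_four]
  have h0 := hhalf (s := 0) (by rw [abs_le]; constructor <;> linarith [ht.1, ht.2])
  have h1 := hhalf (s := t) (by rw [abs_le]; constructor <;> linarith [ht.1, ht.2])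
  rw [geodesicOf_zero] at h0
  exact haveCommonComplement_of_norm_sub_lt_one hP.isIdempotentElem (hproj t).isIdempotentElem
    (hproj _).isIdempotentElem h0 h1

end CompactGenerator

/-! ### Curves on the unit sphere -/

section PiecewiseC1

variable {E : Type*} [NormedAddCommGroup E] [NormedSpace ℝ E]

theorem IsPiecewiseC1.induction {γ : ℝ → E} (h : IsPiecewiseC1 γ) {C : ℝ → Prop} (zero : C 0)
    (step : ∀ a b, a < b → Icc a b ⊆ Icc 0 1 → ContDiffOn ℝ 1 γ (Icc a b) → C a → C b) : C 1 := by
  obtain ⟨n, s, hs, h0, h1, hpiece⟩ := h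
  have hmem (i : Fin (n + 1)) : s i ∈ Icc (0 : ℝ) 1 :=
    ⟨h0 ▸ hs.monotone (Fin.zero_le i), h1 ▸ hs.monotone (Fin.le_last i)⟩
  have hall (i : Fin (n + 1)) : C (s i) := by
    induction i using Fin.induction with
    | zero => rwa [h0]
    | succ i ih =>
      exact step _ _ (hs i.castSucc_lt_succ) (Icc_subset_Icc (hmem _).1 (hmem _).2) (hpiece i) ih
  exact h1 ▸ hall (Fin.last n)

theorem IsPiecewiseC1.contDiff_comp {F : Type*} [NormedAddCommGroup F] [NormedSpace ℝ F]
    {γ : ℝ → E} (h : IsPiecewiseC1 γ) {f : E → F} (hf : ContDiff ℝ 1 f) :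
    IsPiecewiseC1 fun t => f (γ t) := by
  obtain ⟨n, s, hs, h0, h1, hpiece⟩ := h
  exact ⟨n, s, hs, h0, h1, fun i => hf.comp_contDiffOn (hpiece i)⟩

theorem differentiableAt_of_contDiffOn_Icc {γ : ℝ → E} {a b t : ℝ}
    (hγ : ContDiffOn ℝ 1 γ (Icc a b)) (ht : t ∈ Ioo a b) : DifferentiableAt ℝ γ t :=
  (hγ.differentiableOn one_ne_zero).differentiableAt (Icc_mem_nhds ht.1 ht.2)

theorem intervalIntegrable_norm_deriv {γ : ℝ → E} {a b : ℝ} (hab : a < b)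
    (hγ : ContDiffOn ℝ 1 γ (Icc a b)) :
    IntervalIntegrable (fun t => ‖deriv γ t‖) MeasureTheory.volume a b := by
  have hcont : ContinuousOn (fun t => ‖derivWithin γ (Icc a b) t‖) (uIcc a b) := by
    rw [uIcc_of_le hab.le]
    exact (hγ.continuousOn_derivWithin (uniqueDiffOn_Icc hab) le_rfl).norm
  refine hcont.intervalIntegrable.congr_uIoo fun t ht => ?_
  rw [uIoo_of_le hab.le] at ht
  exact congrArg norm (derivWithin_of_mem_nhds (Icc_mem_nhds ht.1 ht.2))

theorem IsPiecewiseC1.intervalIntegrable_norm_deriv {γ : ℝ → E} (h : IsPiecewiseC1 γ) :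
    IntervalIntegrable (fun t => ‖deriv γ t‖) MeasureTheory.volume 0 1 :=
  h.induction .refl fun _ _ hab _ hγ hint =>
    hint.trans (CommonComplement.intervalIntegrable_norm_deriv hab hγ)

theorem IsPiecewiseC1.ae_differentiableAt {γ : ℝ → E} (h : IsPiecewiseC1 γ) :
    ∀ᵐ t ∂MeasureTheory.volume, t ∈ Icc (0 : ℝ) 1 → DifferentiableAt ℝ γ t := by
  refine h.induction (C := fun a =>
    ∀ᵐ t ∂MeasureTheory.volume, t ∈ Icc (0 : ℝ) a → DifferentiableAt ℝ γ t) ?_ ?_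
  · filter_upwards [MeasureTheory.Measure.ae_ne _ 0] with t h0 ht
    exact absurd (le_antisymm ht.2 ht.1) h0
  · intro a b _ _ hγ hdiff
    filter_upwards [hdiff, MeasureTheory.Measure.ae_ne _ b] with t hta hb ht
    rcases le_or_gt t a with hle | hlt
    · exact hta ⟨ht.1, hle⟩
    · exact differentiableAt_of_contDiffOn_Icc hγ ⟨hlt, ht.2.lt_of_ne hb⟩

end PiecewiseC1

section Sphere

variable {E : Type*} [NormedAddCommGroup E] [InnerProductSpace ℝ E]

theorem angle_eq_arccos_inner {u v : E} (hu : ‖u‖ = 1) (hv : ‖v‖ = 1) :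
    InnerProductGeometry.angle u v = Real.arccos (inner ℝ u v) := by
  rw [InnerProductGeometry.angle, hu, hv, mul_one, div_one]

theorem abs_inner_le_sqrt_one_sub_inner_sq_mul_norm {u v w : E} (hu : ‖u‖ = 1) (hv : ‖v‖ = 1)
    (hvw : inner ℝ v w = 0) : |inner ℝ u w| ≤ √(1 - inner ℝ u v ^ 2) * ‖w‖ := by
  have hnorm : ‖u - inner ℝ u v • v‖ = √(1 - inner ℝ u v ^ 2) := by
    have hsq : ‖u - inner ℝ u v • v‖ ^ 2 = 1 - inner ℝ u v ^ 2 := by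
      rw [norm_sub_sq_real, inner_smul_right, norm_smul, hu, hv, mul_one, Real.norm_eq_abs, sq_abs]
      ring
    rw [← hsq, Real.sqrt_sq (norm_nonneg _)]
  calc |inner ℝ u w| = |inner ℝ (u - inner ℝ u v • v) w| := by
        rw [inner_sub_left, inner_smul_left, hvw, mul_zero, sub_zero]
    _ ≤ ‖u - inner ℝ u v • v‖ * ‖w‖ := abs_real_inner_le_norm _ _
    _ = √(1 - inner ℝ u v ^ 2) * ‖w‖ := by rw [hnorm]

theorem inner_eq_zero_of_hasDerivAt {v : ℝ → E} {v' : E} {t : ℝ} (hv : HasDerivAt v v' t)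
    (hunit : ∀ᶠ s in nhds t, ‖v s‖ = 1) : inner ℝ (v t) v' = 0 := by
  have hconst : (fun s => ‖v s‖ ^ 2) =ᶠ[nhds t] fun _ => (1 : ℝ) :=
    hunit.mono fun s hs => by simp only [hs, one_pow]
  have hzero := hv.norm_sq.unique ((hasDerivAt_const t (1 : ℝ)).congr_of_eventuallyEq hconst)
  exact (mul_eq_zero.1 hzero).resolve_left two_ne_zero

theorem exists_hasDerivAt_arccos_mul_inner {v : ℝ → E} {v' u : E} {t r : ℝ}
    (hv : HasDerivAt v v' t) (hunit : ∀ᶠ s in nhds t, ‖v s‖ = 1) (hu : ‖u‖ = 1) (hr0 : 0 < r)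
    (hr1 : r < 1) : ∃ d, HasDerivAt (fun s => Real.arccos (r * inner ℝ u (v s))) d t ∧
      d ≤ ‖v'‖ := by
  obtain ⟨c, hc⟩ : ∃ c, c = inner ℝ u (v t) := ⟨_, rfl⟩
  have hcsq : c ^ 2 ≤ 1 := by
    rw [sq_le_one_iff_abs_le_one, hc]
    simpa only [hu, hunit.self_of_nhds, mul_one] using abs_real_inner_le_norm u (v t)
  have hrsq : r ^ 2 < 1 := by nlinarith
  have hrc : (r * c) ^ 2 < 1 := by nlinarith [sq_nonneg c, sq_nonneg r]
  have hsqrt : 0 < √(1 - (r * c) ^ 2) := Real.sqrt_pos.2 (by linarith)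
  have hinner : HasDerivAt (fun s => r * inner ℝ u (v s)) (r * inner ℝ u v') t := by
    simpa only [inner_zero_left, add_zero] using ((hasDerivAt_const t u).inner ℝ hv).const_mul r
  obtain ⟨hgt, hlt⟩ := abs_lt.1 ((sq_lt_one_iff_abs_lt_one _).1 hrc)
  rw [hc] at hgt hlt
  refine ⟨_, HasDerivAt.comp (h₂ := Real.arccos) (h := fun s => r * inner ℝ u (v s)) t
    (Real.hasDerivAt_arccos hgt.ne' hlt.ne) hinner, ?_⟩
  rw [← hc, neg_mul, one_div_mul_eq_div, ← neg_div, div_le_iff₀ hsqrt]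
  have hbound := abs_inner_le_sqrt_one_sub_inner_sq_mul_norm hu hunit.self_of_nhds
    (inner_eq_zero_of_hasDerivAt hv hunit)
  rw [← hc] at hbound
  have hsqrt_le : r * √(1 - c ^ 2) ≤ √(1 - (r * c) ^ 2) := by
    refine Real.le_sqrt_of_sq_le ?_
    rw [mul_pow, Real.sq_sqrt (by linarith)]
    linarith
  calc -(r * inner ℝ u v') ≤ r * |inner ℝ u v'| := by
        rw [← mul_neg]
        exact mul_le_mul_of_nonneg_left (neg_le_abs _) hr0.le
    _ ≤ r * (√(1 - c ^ 2) * ‖v'‖) := by gcongr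
    _ = r * √(1 - c ^ 2) * ‖v'‖ := (mul_assoc _ _ _).symm
    _ ≤ ‖v'‖ * √(1 - (r * c) ^ 2) := by
        rw [mul_comm]
        gcongr

theorem angle_sub_angle_le_integral_norm_deriv {v : ℝ → E} {u : E} {a b : ℝ} (hab : a < b)
    (hv : ContDiffOn ℝ 1 v (Icc a b)) (hunit : ∀ t ∈ Icc a b, ‖v t‖ = 1) (hu : ‖u‖ = 1) :
    InnerProductGeometry.angle u (v b) - InnerProductGeometry.angle u (v a) ≤
      ∫ t in a..b, ‖deriv v t‖ := by
  have hle {r : ℝ} (hr : r ∈ Ioo (0 : ℝ) 1) :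
      Real.arccos (r * inner ℝ u (v b)) - Real.arccos (r * inner ℝ u (v a)) ≤
        ∫ t in a..b, ‖deriv v t‖ := by
    have hderiv : ∀ t ∈ Ioo a b, ∃ d,
        HasDerivAt (fun s => Real.arccos (r * inner ℝ u (v s))) d t ∧ d ≤ ‖deriv v t‖ :=
      fun t ht => exists_hasDerivAt_arccos_mul_inner
        (differentiableAt_of_contDiffOn_Icc hv ht).hasDerivAt
        (Filter.mem_of_superset (Icc_mem_nhds ht.1 ht.2) hunit) hu hr.1 hr.2
    choose! d hd hdle using hderiv
    refine intervalIntegral.sub_le_integral_of_hasDeriv_right_of_le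
      (g := fun s => Real.arccos (r * inner ℝ u (v s))) hab.le ?_
      (fun t ht => (hd t ht).hasDerivWithinAt) ?_ hdle
    · exact Real.continuous_arccos.comp_continuousOn
        (continuousOn_const.mul (continuousOn_const.inner hv.continuousOn))
    · exact (intervalIntegrable_iff_integrableOn_Icc_of_le hab.le).1
        (intervalIntegrable_norm_deriv hab hv)
  have hcont (c : ℝ) : Filter.Tendsto (fun r : ℝ => Real.arccos (r * c)) (nhdsWithin 1 (Iio 1))
      (nhds (Real.arccos c)) := by
    have : Continuous fun r : ℝ => Real.arccos (r * c) := by fun_prop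
    simpa only [one_mul] using (this.tendsto 1).mono_left nhdsWithin_le_nhds
  rw [angle_eq_arccos_inner hu (hunit b (right_mem_Icc.2 hab.le)),
    angle_eq_arccos_inner hu (hunit a (left_mem_Icc.2 hab.le))]
  exact le_of_tendsto ((hcont _).sub (hcont _))
    (Filter.mem_of_superset (Ioo_mem_nhdsLT zero_lt_one) fun _ => hle)

theorem IsPiecewiseC1.angle_le_integral_norm_deriv {v : ℝ → E} (h : IsPiecewiseC1 v)
    (hunit : ∀ t ∈ Icc (0 : ℝ) 1, ‖v t‖ = 1) :
    InnerProductGeometry.angle (v 0) (v 1) ≤ ∫ t in (0 : ℝ)..1, ‖deriv v t‖ := by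
  have hv0 : ‖v 0‖ = 1 := hunit 0 (left_mem_Icc.2 zero_le_one)
  refine (h.induction (C := fun a =>
    IntervalIntegrable (fun t => ‖deriv v t‖) MeasureTheory.volume 0 a ∧
      InnerProductGeometry.angle (v 0) (v a) ≤ ∫ t in (0 : ℝ)..a, ‖deriv v t‖) ?_ ?_).2
  · rw [InnerProductGeometry.angle_self (norm_ne_zero_iff.1 (hv0 ▸ one_ne_zero)),
      intervalIntegral.integral_same]
    exact ⟨.refl, le_rfl⟩
  · rintro a b hab hsub hv ⟨hint, hangle⟩
    have hint' := CommonComplement.intervalIntegrable_norm_deriv hab hv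
    refine ⟨hint.trans hint', ?_⟩
    rw [← intervalIntegral.integral_add_adjacent_intervals hint hint']
    linarith [angle_sub_angle_le_integral_norm_deriv hab hv (fun t ht => hunit t (hsub ht)) hv0]

end Sphere

/-! ### Minimality -/

theorem sqrt_sq_integral_add_sq_integral_le {f g : ℝ → ℝ} {a b : ℝ} (hab : a ≤ b)
    (hf : IntervalIntegrable f MeasureTheory.volume a b)
    (hg : IntervalIntegrable g MeasureTheory.volume a b) :
    √((∫ t in a..b, f t) ^ 2 + (∫ t in a..b, g t) ^ 2) ≤ ∫ t in a..b, √(f t ^ 2 + g t ^ 2) := by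
  have hf' : IntervalIntegrable (fun t => (f t : ℂ)) MeasureTheory.volume a b :=
    ⟨hf.1.ofReal, hf.2.ofReal⟩
  have hg' : IntervalIntegrable (fun t => (g t : ℂ)) MeasureTheory.volume a b :=
    ⟨hg.1.ofReal, hg.2.ofReal⟩
  have hcomplex : ∫ t in a..b, ((f t : ℂ) + g t * Complex.I) =
      (∫ t in a..b, f t : ℝ) + (∫ t in a..b, g t : ℝ) * Complex.I := by
    rw [intervalIntegral.integral_add hf' (hg'.mul_const _),
      intervalIntegral.integral_mul_const, intervalIntegral.integral_ofReal,
      intervalIntegral.integral_ofReal]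
  simp only [← Complex.norm_add_mul_I]
  rw [← hcomplex]
  exact intervalIntegral.norm_integral_le_integral_norm hab

section Minimality

variable {H : Type*} [NormedAddCommGroup H] [InnerProductSpace ℂ H]

theorem norm_symmetry_apply [CompleteSpace H] {P : H →L[ℂ] H} (hP : IsStarProjection P) (x : H) :
    ‖symmetry P x‖ = ‖x‖ := by
  have hunitary : symmetry P ∈ unitary (H →L[ℂ] H) := symmetry_mem_unitary hP
  exact ContinuousLinearMap.norm_map_of_mem_unitary hunitary x

theorem sqrt_add_sq_le_curveLength {γ : ℝ → (H →L[ℂ] H) × (H →L[ℂ] H)} (h : IsPiecewiseC1 γ)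
    {a b : ℝ} (ha : 0 ≤ a) (hb : 0 ≤ b)
    (hγ₁ : a ≤ ∫ t in (0 : ℝ)..1, ‖deriv (fun s => (γ s).1) t‖)
    (hγ₂ : b ≤ ∫ t in (0 : ℝ)..1, ‖deriv (fun s => (γ s).2) t‖) :
    √(a ^ 2 + b ^ 2) ≤ curveLength γ := by
  refine le_trans ?_ (sqrt_sq_integral_add_sq_integral_le zero_le_one
    (h.contDiff_comp contDiff_fst).intervalIntegrable_norm_deriv
    (h.contDiff_comp contDiff_snd).intervalIntegrable_norm_deriv)
  gcongr

attribute [local instance] InnerProductSpace.complexToReal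

theorem angle_exp_mul_I_smul {w : H} (hw : ‖w‖ = 1) {θ : ℝ} (hθ : |θ| ≤ Real.pi) :
    InnerProductGeometry.angle w (Complex.exp (θ * Complex.I) • w) = |θ| := by
  have hnorm : ‖Complex.exp (θ * Complex.I) • w‖ = 1 := by
    rw [norm_smul, Complex.norm_exp_ofReal_mul_I, hw, one_mul]
  rw [angle_eq_arccos_inner hw hnorm, real_inner_eq_re_inner ℂ, inner_smul_right,
    inner_self_eq_norm_sq_to_K, hw, RCLike.ofReal_one, one_pow, mul_one, RCLike.re_eq_complex_re,
    Complex.exp_ofReal_mul_I_re, ← Real.cos_abs, Real.arccos_cos (abs_nonneg θ) hθ]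

variable [CompleteSpace H]

theorem exp_apply_of_apply_eq_smul {T : H →L[ℂ] H} {v : H} {c : ℂ} (h : T v = c • v) :
    NormedSpace.exp T v = Complex.exp c • v := by
  have hpow (n : ℕ) : (T ^ n) v = c ^ n • v := by
    induction n with
    | zero => rw [pow_zero, pow_zero, one_smul, one_apply_eq_self]
    | succ n ih => rw [pow_succ', mul_apply_eq_comp, ih, map_smul, h, smul_smul, pow_succ]
  have hT := (NormedSpace.exp_series_hasSum_exp' (𝕂 := ℂ) T).mapL
    (ContinuousLinearMap.apply ℂ H v)
  have hc := ((NormedSpace.exp_series_hasSum_exp' (𝕂 := ℂ) c).smul_const v)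
  rw [← Complex.exp_eq_exp_ℂ] at hc
  refine hT.unique (hc.congr_fun fun n => ?_)
  simp [hpow, smul_smul]

theorem IsGeodesicGenerator.exists_angle_symmetry_apply_eq_norm {P Q Y : H →L[ℂ] H}
    (hP : IsStarProjection P) (hY : IsGeodesicGenerator P Q Y) (hcompact : IsCompactOperator Y)
    (hne : Y ≠ 0) :
    ∃ v : H, ‖v‖ = 1 ∧
      InnerProductGeometry.angle (symmetry P v) (symmetry Q v) = ‖Y‖ := by
  obtain ⟨v, r, hv, hr, heig⟩ := exists_unit_eigenvector_norm hY.isSelfAdjoint hcompact hne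
  have heig' : Y (symmetry P v) = (-r : ℂ) • symmetry P v := by
    have hanti : symmetry P (Y v) = -Y (symmetry P v) :=
      congrArg (fun T : H →L[ℂ] H => T v) hY.symmetry_mul
    rw [neg_smul, ← map_smul, ← heig, hanti, neg_neg]
  have hQv : symmetry Q v = Complex.exp ((-r : ℝ) * Complex.I) • symmetry P v := by
    rw [← hY.exp_mul_symmetry, mul_apply_eq_comp]
    refine exp_apply_of_apply_eq_smul ?_
    rw [smul_apply, heig', smul_smul, mul_comm, Complex.ofReal_neg]
  refine ⟨v, hv, ?_⟩
  rw [hQv, angle_exp_mul_I_smul ?_ (by rw [abs_neg, hr]; exact hY.norm_le_pi), abs_neg, hr]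
  rw [norm_symmetry_apply hP, hv]

theorem IsPiecewiseC1.angle_symmetry_apply_le {γ : ℝ → H →L[ℂ] H} (h : IsPiecewiseC1 γ)
    (hγ : ∀ t ∈ Icc (0 : ℝ) 1, IsStarProjection (γ t)) {v : H} (hv : ‖v‖ = 1) :
    InnerProductGeometry.angle (symmetry (γ 0) v) (symmetry (γ 1) v) ≤
      2 * ∫ t in (0 : ℝ)..1, ‖deriv γ t‖ := by
  let ev : (H →L[ℂ] H) →L[ℝ] H := (ContinuousLinearMap.apply ℂ H v).restrictScalars ℝ
  have hcurve : IsPiecewiseC1 fun t => symmetry (γ t) v :=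
    h.contDiff_comp (f := fun T => ev (symmetry T))
      (ev.contDiff.comp ((contDiff_const.mul contDiff_id).sub contDiff_const))
  have hunit : ∀ t ∈ Icc (0 : ℝ) 1, ‖symmetry (γ t) v‖ = 1 := fun t ht => by
    rw [norm_symmetry_apply (hγ t ht), hv]
  have hspeed : ∀ᵐ t ∂MeasureTheory.volume, t ∈ Icc (0 : ℝ) 1 →
      ‖deriv (fun s => symmetry (γ s) v) t‖ ≤ 2 * ‖deriv γ t‖ := by
    filter_upwards [h.ae_differentiableAt] with t hdiff ht
    have hderiv : HasDerivAt (fun s => symmetry (γ s) v) ((2 * deriv γ t) v) t :=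
      ev.hasFDerivAt.comp_hasDerivAt t (hasDerivAt_symmetry (hdiff ht).hasDerivAt)
    calc ‖deriv (fun s => symmetry (γ s) v) t‖ = ‖(2 : ℂ) • deriv γ t v‖ := by
          rw [hderiv.deriv, two_mul, two_smul, add_apply]
      _ ≤ 2 * ‖deriv γ t‖ := by
          rw [norm_smul, Complex.norm_ofNat]
          gcongr
          exact (deriv γ t).unit_le_opNorm v hv.le
  refine (hcurve.angle_le_integral_norm_deriv hunit).trans ?_
  rw [← intervalIntegral.integral_const_mul]
  exact intervalIntegral.integral_mono_ae_restrict zero_le_one hcurve.intervalIntegrable_norm_deriv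
    (h.intervalIntegrable_norm_deriv.const_mul 2)
    ((MeasureTheory.ae_restrict_iff' measurableSet_Icc).2 hspeed)

theorem IsGeodesicGenerator.norm_div_two_le_integral_norm_deriv {P Q Y : H →L[ℂ] H}
    (hY : IsGeodesicGenerator P Q Y) (hcompact : IsCompactOperator Y) {γ : ℝ → H →L[ℂ] H}
    (h : IsPiecewiseC1 γ) (hγ : ∀ t ∈ Icc (0 : ℝ) 1, IsStarProjection (γ t)) (h0 : γ 0 = P)
    (h1 : γ 1 = Q) : ‖Y‖ / 2 ≤ ∫ t in (0 : ℝ)..1, ‖deriv γ t‖ := by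
  rcases eq_or_ne Y 0 with rfl | hne
  · rw [norm_zero, zero_div]
    exact intervalIntegral.integral_nonneg zero_le_one fun t _ => norm_nonneg _
  have hP : IsStarProjection P := h0 ▸ hγ 0 (left_mem_Icc.2 zero_le_one)
  obtain ⟨v, hv, hangle⟩ := hY.exists_angle_symmetry_apply_eq_norm hP hcompact hne
  have hle := h.angle_symmetry_apply_le hγ hv
  rw [h0, h1, hangle] at hle
  linarith

theorem curveLength_geodesicOf_prodMk {P₁ P₂ Y₁ Y₂ : H →L[ℂ] H} (hP₁ : IsStarProjection P₁)
    (hP₂ : IsStarProjection P₂) (hY₁ : IsCodiagonal P₁ Y₁) (hY₂ : IsCodiagonal P₂ Y₂) :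
    curveLength (fun t => (geodesicOf P₁ Y₁ t, geodesicOf P₂ Y₂ t)) =
      √((‖Y₁‖ / 2) ^ 2 + (‖Y₂‖ / 2) ^ 2) := by
  simp only [curveLength, hY₁.norm_deriv_geodesicOf hP₁, hY₂.norm_deriv_geodesicOf hP₂,
    intervalIntegral.integral_const, sub_zero, one_smul]

theorem isMinimizingGeodesic_geodesicOf_prodMk {P₁ P₂ Q₁ Q₂ Y₁ Y₂ : H →L[ℂ] H}
    (hP₁ : IsStarProjection P₁) (hP₂ : IsStarProjection P₂) (hY₁ : IsGeodesicGenerator P₁ Q₁ Y₁)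
    (hY₂ : IsGeodesicGenerator P₂ Q₂ Y₂) (hcompact₁ : IsCompactOperator Y₁)
    (hcompact₂ : IsCompactOperator Y₂) :
    IsMinimizingGeodesic fun t => (geodesicOf P₁ Y₁ t, geodesicOf P₂ Y₂ t) := by
  refine ⟨hY₁.isGeodesic_geodesicOf hP₁, hY₂.isGeodesic_geodesicOf hP₂, fun γ hγ hproj h0 h1 => ?_⟩
  simp only [geodesicOf_zero, geodesicOf_one hY₁.exp_mul_symmetry,
    geodesicOf_one hY₂.exp_mul_symmetry] at h0 h1
  rw [curveLength_geodesicOf_prodMk hP₁ hP₂ hY₁.toIsCodiagonal hY₂.toIsCodiagonal]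
  refine sqrt_add_sq_le_curveLength hγ (by positivity) (by positivity) ?_ ?_
  · exact hY₁.norm_div_two_le_integral_norm_deriv hcompact₁ (hγ.contDiff_comp contDiff_fst)
      (fun t ht => (hproj t ht).1) (congrArg Prod.fst h0) (congrArg Prod.fst h1)
  · exact hY₂.norm_div_two_le_integral_norm_deriv hcompact₂ (hγ.contDiff_comp contDiff_snd)
      (fun t ht => (hproj t ht).2) (congrArg Prod.snd h0) (congrArg Prod.snd h1)

end Minimality

/-! ### The restricted Grassmannian -/

section RestrictedGrassmannian

variable {H : Type*} [NormedAddCommGroup H] [InnerProductSpace ℂ H] [CompleteSpace H]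
  {R P Q : H →L[ℂ] H} {k j : ℤ}

theorem isCompactOperator_sub_of_mem_grRes (hP : P ∈ GrRes R) (hQ : Q ∈ GrRes R) :
    IsCompactOperator (P - Q : H →L[ℂ] H) :=
  isCompactOperator_sub_trans hP.2 (isCompactOperator_sub_comm hQ.2)

theorem pairIndex_of_mem_grResComp (hR : R ∈ projections H) (hP : P ∈ GrResComp R k)
    (hQ : Q ∈ GrResComp R j) : pairIndex P Q = j - k := by
  rw [pairIndex_eq_sub hR.isIdempotentElem hP.1.1.isIdempotentElem hQ.1.1.isIdempotentElem
    (isCompactOperator_sub_comm hP.1.2) (isCompactOperator_sub_comm hQ.1.2), hP.2, hQ.2]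

theorem exists_isGeodesicGenerator_of_mem_grResComp (hR : R ∈ projections H)
    (hP : P ∈ GrResComp R k) (hQ : Q ∈ GrResComp R k) :
    ∃ Y : H →L[ℂ] H, IsGeodesicGenerator P Q Y ∧ IsCompactOperator Y := by
  have hPQ := isCompactOperator_sub_of_mem_grRes hP.1 hQ.1
  obtain ⟨Y, hY⟩ := exists_isGeodesicGenerator hP.1.1 hQ.1.1 hPQ
    ((pairIndex_of_mem_grResComp hR hP hQ).trans (sub_self k))
  exact ⟨Y, hY, hY.isCompactOperator hP.1.1 hPQ⟩

theorem geodesicOf_mem_grResComp {Y : H →L[ℂ] H} (hR : R ∈ projections H)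
    (hP : P ∈ GrResComp R k) (hY : IsCodiagonal P Y) (hcompact : IsCompactOperator Y)
    (hπ : ‖Y‖ ≤ Real.pi) {t : ℝ} (ht : t ∈ Icc (0 : ℝ) 1) : geodesicOf P Y t ∈ GrResComp R k := by
  have hproj := hY.isStarProjection_geodesicOf hP.1.1 t
  have hsub := isCompactOperator_geodesicOf_sub (P := P) hY.isSelfAdjoint hcompact t
  have hmem : geodesicOf P Y t ∈ GrRes R := ⟨hproj, isCompactOperator_sub_trans hsub hP.1.2⟩
  have hindex : pairIndex P (geodesicOf P Y t) = 0 :=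
    pairIndex_eq_zero_of_haveCommonComplement hP.1.1.isIdempotentElem hproj.isIdempotentElem
      (isCompactOperator_sub_comm hsub) (haveCommonComplement_geodesicOf hP.1.1 hY hπ ht)
  rw [pairIndex_of_mem_grResComp hR hP ⟨hmem, rfl⟩, sub_eq_zero] at hindex
  exact ⟨hmem, hindex⟩

theorem joinedByMinimizingGeodesicIn_grResComp_prod (hR : R ∈ projections H)
    {a b : (H →L[ℂ] H) × (H →L[ℂ] H)} (ha : a ∈ GrResComp R k ×ˢ GrResComp R j)
    (hb : b ∈ GrResComp R k ×ˢ GrResComp R j) :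
    JoinedByMinimizingGeodesicIn (GrResComp R k ×ˢ GrResComp R j) a b := by
  obtain ⟨Y₁, hY₁, hcompact₁⟩ := exists_isGeodesicGenerator_of_mem_grResComp hR ha.1 hb.1
  obtain ⟨Y₂, hY₂, hcompact₂⟩ := exists_isGeodesicGenerator_of_mem_grResComp hR ha.2 hb.2
  refine ⟨fun t => (geodesicOf a.1 Y₁ t, geodesicOf a.2 Y₂ t),
    isMinimizingGeodesic_geodesicOf_prodMk ha.1.1.1 ha.2.1.1 hY₁ hY₂ hcompact₁ hcompact₂,
    ?_, ?_, fun t ht => ⟨?_, ?_⟩⟩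
  · simp only [geodesicOf_zero]
  · simp only [geodesicOf_one hY₁.exp_mul_symmetry, geodesicOf_one hY₂.exp_mul_symmetry]
  · exact geodesicOf_mem_grResComp hR ha.1 hY₁.toIsCodiagonal hcompact₁ hY₁.norm_le_pi ht
  · exact geodesicOf_mem_grResComp hR ha.2 hY₂.toIsCodiagonal hcompact₂ hY₂.norm_le_pi ht

theorem JoinedByMinimizingGeodesicIn.mono {A B : Set ((H →L[ℂ] H) × (H →L[ℂ] H))}
    {a b : (H →L[ℂ] H) × (H →L[ℂ] H)} (h : JoinedByMinimizingGeodesicIn A a b) (hAB : A ⊆ B) :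
    JoinedByMinimizingGeodesicIn B a b :=
  let ⟨δ, hδ, h0, h1, hA⟩ := h
  ⟨δ, hδ, h0, h1, fun t ht => hAB (hA t ht)⟩

theorem grResComp_prod_subset_delta (hR : R ∈ projections H) (k : ℤ) :
    GrResComp R k ×ˢ GrResComp R k ⊆ Delta H := by
  rintro ⟨P, Q⟩ ⟨hP, hQ⟩
  obtain ⟨Y, hY, -⟩ := exists_isGeodesicGenerator_of_mem_grResComp hR hP hQ
  have hcompl := haveCommonComplement_geodesicOf hP.1.1 hY.toIsCodiagonal hY.norm_le_pi
    (right_mem_Icc.2 zero_le_one)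
  rw [geodesicOf_one hY.exp_mul_symmetry] at hcompl
  exact ⟨hP.1.1, hQ.1.1, hcompl⟩

theorem grResComp_prod_subset_gamma (hR : R ∈ projections H) (hkj : k ≠ j) :
    GrResComp R k ×ˢ GrResComp R j ⊆ Gamma H := by
  rintro ⟨P, Q⟩ ⟨hP, hQ⟩
  refine ⟨hP.1.1, hQ.1.1, fun hcompl => hkj ?_⟩
  have hindex := pairIndex_eq_zero_of_haveCommonComplement hP.1.1.isIdempotentElem
    hQ.1.1.isIdempotentElem (isCompactOperator_sub_of_mem_grRes hP.1 hQ.1) hcompl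
  rw [pairIndex_of_mem_grResComp hR hP hQ, sub_eq_zero] at hindex
  exact hindex.symm

end RestrictedGrassmannian

end CommonComplement

end

open CommonComplement in
theorem mainTheorem9_general {H : Type*} [NormedAddCommGroup H] [InnerProductSpace ℂ H]
    [CompleteSpace H] (Pplus : H →L[ℂ] H) (hPplus : Pplus ∈ projections H) :
    (∀ k : ℤ,
      GrResComp Pplus k ×ˢ GrResComp Pplus k ⊆ Delta H ∧
        ∀ a ∈ GrResComp Pplus k ×ˢ GrResComp Pplus k,
        ∀ b ∈ GrResComp Pplus k ×ˢ GrResComp Pplus k,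
          JoinedByMinimizingGeodesicIn (Delta H) a b) ∧
    (∀ k j : ℤ, k ≠ j →
      GrResComp Pplus k ×ˢ GrResComp Pplus j ⊆ Gamma H ∧
        ∀ a ∈ GrResComp Pplus k ×ˢ GrResComp Pplus j,
        ∀ b ∈ GrResComp Pplus k ×ˢ GrResComp Pplus j,
          JoinedByMinimizingGeodesicIn (Gamma H) a b) := by
  refine ⟨fun k => ?_, fun k j hkj => ?_⟩
  · have hsub := grResComp_prod_subset_delta hPplus k
    exact ⟨hsub, fun a ha b hb =>
      (joinedByMinimizingGeodesicIn_grResComp_prod hPplus ha hb).mono hsub⟩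
  · have hsub := grResComp_prod_subset_gamma hPplus hkj
    exact ⟨hsub, fun a ha b hb =>
      (joinedByMinimizingGeodesicIn_grResComp_prod hPplus ha hb).mono hsub⟩

theorem mainTheorem9 {H : Type*} [NormedAddCommGroup H] [InnerProductSpace ℂ H] [CompleteSpace H]
    [TopologicalSpace.SeparableSpace H] (Pplus : H →L[ℂ] H)
    (hPplus : Pplus ∈ CommonComplement.projections H)
    (hrange : ¬ FiniteDimensional ℂ Pplus.range) (hker : ¬ FiniteDimensional ℂ Pplus.ker) :
    (∀ k : ℤ,
      CommonComplement.GrResComp Pplus k ×ˢ CommonComplement.GrResComp Pplus k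
          ⊆ CommonComplement.Delta H ∧
        ∀ a ∈ CommonComplement.GrResComp Pplus k ×ˢ CommonComplement.GrResComp Pplus k,
        ∀ b ∈ CommonComplement.GrResComp Pplus k ×ˢ CommonComplement.GrResComp Pplus k,
          CommonComplement.JoinedByMinimizingGeodesicIn (CommonComplement.Delta H) a b) ∧
    (∀ k j : ℤ, k ≠ j →
      CommonComplement.GrResComp Pplus k ×ˢ CommonComplement.GrResComp Pplus j
          ⊆ CommonComplement.Gamma H ∧
        ∀ a ∈ CommonComplement.GrResComp Pplus k ×ˢ CommonComplement.GrResComp Pplus j,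
        ∀ b ∈ CommonComplement.GrResComp Pplus k ×ˢ CommonComplement.GrResComp Pplus j,
          CommonComplement.JoinedByMinimizingGeodesicIn (CommonComplement.Gamma H) a b) :=
  mainTheorem9_general Pplus hPplus
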